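/- Let $d\in\{2,3\}$ and let $\mathcal T_H=\{K_1,\dots,K_N\}$ be a conforming mesh of a domain $\Omega\subset\mathbb R^d$ by open convex quadrilaterals ($d=2$) or hexahedra ($d=3$) of diameter at most $H$, each containing a ball of radius $\rho H$. Let $\mu,\lambda$ be measurable and bounded on $\Omega$ with $\mu\ge c>0$, $\lambda\ge 0$; let $\varepsilon(v)=\frac12(\nabla v+\nabla v^{T})$, $\sigma(v)=2\mu\,\varepsilon(v)+\lambda(\nabla\cdot v)I$, and for $S\subset\Omega$ $$a_S(u,v)=\int_S\sigma(u):\varepsilon(v)\,dx,\qquad s_S(u,v)=\int_S\tilde\kappa\,u\cdot v\,dx,\qquad \tilde\kappa=\sum_n(\lambda+2\mu)\,|\nabla\chi_n|^2 ,$$ where $\{\chi_n\}$ is a Lipschitz, nonnegative partition of unity on $\Omega$ indexed by the mesh nodes, $\chi_n$ vanishing on the cells that do not have the node $n$ as a vertex. Write $\|v\|_a^2=a_\Omega(v,v)$, $\|v\|_s^2=s_\Omega(v,v)$. Let $\Gamma_a\subset\partial\Omega$ be closed and $H^1_a(\Omega)=\{v\in H^1(\Omega;\mathbb R^d): v=0\text{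 on }\Gamma_a\}$. On every cell $K_j$ let $V(K_j)$ be a snapshot space with $H^1_a(\Omega)|_{K_j}\subset V(K_j)\subset H^1(K_j;\mathbb R^d)$, and let $\phi_j^1,\dots,\phi_j^{g_j}\in V(K_j)$ be $s_{K_j}$-orthogonal eigenfunctions for the $g_j$ smallest eigenvalues $\theta_j^1\le\dots\le\theta_j^{g_j}$ of $a_{K_j}(\phi,v)=\theta\,s_{K_j}(\phi,v)$ for all $v\in V(K_j)$. Let $V_{\rm aux}(K_j)=\operatorname{span}\{\phi_j^i\}_{i\le g_j}$, let $\pi_j$ be the $s_{K_j}$-orthogonal projection onto $V_{\rm aux}(K_j)$, extended by zero outside $K_j$, let $\pi=\sum_j\pi_j$, and let $$W_h=\{w\in H^1_a(\Omega):\pi w=0\},\qquad W_h(S)=\{w\in W_h: w=0\text{ in }\Omega\setminus S\}.$$ Let $\theta_j^{g_j+1}$ be the minimum (infimum) of $a_{K_j}(v,v)/s_{K_j}(v,v)$ over the $v\in V(K_j)$ that are $s_{K_j}$-orthogonal to $V_{\rm aux}(K_j)$. Let $A_*$ be the best constant $A$ such that for every $j$ each $q\in V_{\rm aux}(K_j)$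 equals $\pi z$ (with $q$ extended by zero) for some $z\in H^1_a(\Omega)$ that vanishes outside $K_j$ and satisfies $\|z\|_a\le A\|q\|_{s(K_j)}$. Finally let $K_{i,0}=K_i$ and $K_{i,m}=\bigcup\{K_j:\overline K_j\cap\overline K_{i,m-1}\ne\emptyset\}\cup\overline K_{i,m-1}$. **Lemma.** For all $\rho,\Lambda>0$ and $A\ge0$ there are constants $C>0$ and $0<\delta<1$, depending only on $d,\rho,\Lambda,A$, such that the following holds for every problem as above with $\theta_j^{g_j+1}\ge\Lambda$ for all $j$ and $A_*\le A$, and for every integer $m\ge1$. For each cell $K=K_i$ let $\mathcal B_K$ be a linear functional with $\mathcal B_K(v)=0$ for all $v\in W_h(\Omega\setminus K)$, let $w^K\in W_h$ satisfy $$\int_\Omega\sigma(w^K):\varepsilon(v)\,dx=\mathcal B_K(v)\qquad\forall v\in W_h,$$ and let $w^K_{i,m}\in W_h(K_{i,m})$ satisfy $$\int_{K_{i,m}}\sigma(w^K_{i,m}):\varepsilon(v)\,dx=\mathcal B_K(v)\qquad\forall v\in W_h(K_{i,m}).$$ Then $$\Big\|\sum_{K\in\mathcal T_H}(w^K-w^K_{i,m})\Big\|_a^2+\Big\|\sum_{K\in\mathcal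 T_H}\pi(w^K-w^K_{i,m})\Big\|_s^2\le C\,m^d\,\delta^m\Big(\sum_{K\in\mathcal T_H}\|w^K\|_a^2+\sum_{K\in\mathcal T_H}\|\pi w^K\|_s^2\Big).$$ -/

import Mathlib

open MeasureTheory Filter Set
open scoped ENNReal ContDiff

noncomputable section

namespace CEM

/-- The space `ℝᵈ` with its Euclidean norm. -/
abbrev E (d : ℕ) := EuclideanSpace ℝ (Fin d)

/-- A displacement together with its gradient, `G x i j = ∂ⱼ uᵢ (x)`. Membership in the Sobolev
spaces below forces the second component to be the weak gradient of the first one. -/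
abbrev Displ (d : ℕ) := (E d → E d) × (E d → Matrix (Fin d) (Fin d) ℝ)

/-- `G` is the weak gradient of the vector field `u` in the open set `U`. -/
def IsWeakGrad {d : ℕ} (U : Set (E d)) (u : E d → E d)
    (G : E d → Matrix (Fin d) (Fin d) ℝ) : Prop :=
  ∀ η : E d → ℝ, ContDiff ℝ ∞ η → HasCompactSupport η → tsupport η ⊆ U →
    ∀ i j : Fin d,
      ∫ x in U, u x i * fderiv ℝ η x (EuclideanSpace.single j 1) = - ∫ x in U, G x i j * η x

theorem integrable_mul_of_test {d : ℕ} {U : Set (E d)} {f η : E d → ℝ}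
    (hf : MemLp f 2 (volume.restrict U)) (hη : Continuous η) (hc : HasCompactSupport η) :
    Integrable (fun x => f x * η x) (volume.restrict U) :=
  hf.integrable_mul ((hη.memLp_of_hasCompactSupport (p := 2) (μ := volume) hc).restrict U)

theorem continuous_partial {d : ℕ} {η : E d → ℝ} (h : ContDiff ℝ ∞ η) (j : Fin d) :
    Continuous fun x => fderiv ℝ η x (EuclideanSpace.single j 1) :=
  (h.continuous_fderiv (by simp)).clm_apply continuous_const

theorem compact_partial {d : ℕ} {η : E d → ℝ} (h : HasCompactSupport η) (j : Fin d) :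
    HasCompactSupport fun x => fderiv ℝ η x (EuclideanSpace.single j 1) :=
  h.fderiv_apply (𝕜 := ℝ) (EuclideanSpace.single j 1)

/-- The Sobolev space `H¹(U; ℝᵈ)`: square integrable fields with square integrable weak gradient. -/
def H1 {d : ℕ} (U : Set (E d)) : Submodule ℝ (Displ d) where
  carrier := {p | (∀ i, MemLp (fun x => p.1 x i) 2 (volume.restrict U)) ∧
    (∀ i j, MemLp (fun x => p.2 x i j) 2 (volume.restrict U)) ∧ IsWeakGrad U p.1 p.2}
  zero_mem' := by
    refine ⟨fun i => ?_, fun i j => ?_, ?_⟩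
    · simp
    · simp
    · intro η _ _ _ i j
      simp
  add_mem' := by
    rintro p q ⟨hp1, hp2, hp3⟩ ⟨hq1, hq2, hq3⟩
    refine ⟨fun i => (hp1 i).add (hq1 i), fun i j => (hp2 i j).add (hq2 i j), ?_⟩
    intro η h1 h2 h3 i j
    have e1 := hp3 η h1 h2 h3 i j
    have e2 := hq3 η h1 h2 h3 i j
    simp only [Prod.fst_add, Prod.snd_add, Pi.add_apply, PiLp.add_apply, Matrix.add_apply, add_mul]
    rw [integral_add (integrable_mul_of_test (hp1 i) (continuous_partial h1 j) (compact_partial h2 j))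
        (integrable_mul_of_test (hq1 i) (continuous_partial h1 j) (compact_partial h2 j)),
      integral_add (integrable_mul_of_test (hp2 i j) h1.continuous h2)
        (integrable_mul_of_test (hq2 i j) h1.continuous h2), e1, e2]
    ring
  smul_mem' := by
    rintro c p ⟨hp1, hp2, hp3⟩
    refine ⟨fun i => (hp1 i).const_mul c, fun i j => (hp2 i j).const_mul c, ?_⟩
    intro η h1 h2 h3 i j
    have e1 := hp3 η h1 h2 h3 i j
    simp only [Prod.smul_fst, Prod.smul_snd, Pi.smul_apply, PiLp.smul_apply, Matrix.smul_apply,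
      smul_eq_mul, mul_assoc]
    rw [integral_const_mul, integral_const_mul, e1]
    ring

/-- Lipschitz fields with compact support that vanish in a neighbourhood of `Γ`. -/
def IsAdmissible {d : ℕ} (Γ : Set (E d)) (ψ : E d → E d) : Prop :=
  (∃ L, LipschitzWith L ψ) ∧ HasCompactSupport ψ ∧ ∃ O, IsOpen O ∧ Γ ⊆ O ∧ ∀ x ∈ O, ψ x = 0

/-- `ψ` is `ε`-close to `p` in `H¹(U)` (componentwise). -/
def IsClose {d : ℕ} (U : Set (E d)) (p : Displ d) (ψ : E d → E d) (ε : ℝ≥0∞) : Prop :=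
  (∀ i, eLpNorm (fun x => p.1 x i - ψ x i) 2 (volume.restrict U) ≤ ε) ∧
  ∀ i j, eLpNorm (fun x => p.2 x i j - fderiv ℝ ψ x (EuclideanSpace.single j 1) i) 2
    (volume.restrict U) ≤ ε

theorem aesm_coord {d : ℕ} {ψ : E d → E d} {L} (h : LipschitzWith L ψ) (i : Fin d)
    (μ : Measure (E d)) : AEStronglyMeasurable (fun x => ψ x i) μ :=
  ((EuclideanSpace.proj (𝕜 := ℝ) i).continuous.comp h.continuous).aestronglyMeasurable

theorem aesm_partial {d : ℕ} (ψ : E d → E d) (i j : Fin d) (μ : Measure (E d)) :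
    AEStronglyMeasurable (fun x => fderiv ℝ ψ x (EuclideanSpace.single j 1) i) μ :=
  ((EuclideanSpace.proj (𝕜 := ℝ) i : E d →L[ℝ] ℝ).continuous.measurable.comp
    (measurable_fderiv_apply_const ℝ ψ (EuclideanSpace.single j 1))).aestronglyMeasurable

/-- `{v ∈ H¹(U; ℝᵈ) : v = 0 on Γ}`, as the closure in `H¹(U)` of the Lipschitz fields that vanish
near `Γ`. -/
def H1Zero {d : ℕ} (U Γ : Set (E d)) : Submodule ℝ (Displ d) where
  carrier := {p | p ∈ H1 U ∧ ∀ ε : ℝ≥0∞, 0 < ε → ∃ ψ, IsAdmissible Γ ψ ∧ IsClose U p ψ ε}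
  zero_mem' := by
    refine ⟨(H1 U).zero_mem, fun ε _ => ⟨0, ⟨⟨0, LipschitzWith.const 0⟩, HasCompactSupport.zero,
      univ, isOpen_univ, subset_univ _, fun _ _ => rfl⟩, fun i => ?_, fun i j => ?_⟩⟩
    · simp
    · simp
  add_mem' := by
    rintro p q ⟨hp, hp'⟩ ⟨hq, hq'⟩
    refine ⟨(H1 U).add_mem hp hq, fun ε hε => ?_⟩
    have hε2 : 0 < ε / 2 := ENNReal.half_pos hε.ne'
    obtain ⟨ψ, ⟨⟨L, hL⟩, hc, O, hO, hΓ, h0⟩, hψ1, hψ2⟩ := hp' _ hε2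
    obtain ⟨ξ, ⟨⟨L', hL'⟩, hc', O', hO', hΓ', h0'⟩, hξ1, hξ2⟩ := hq' _ hε2
    by_cases hdiff : ε = ⊤
    · subst hdiff
      exact ⟨0, ⟨⟨0, LipschitzWith.const 0⟩, HasCompactSupport.zero,
        univ, isOpen_univ, subset_univ _, fun _ _ => rfl⟩, fun _ => le_top, fun _ _ => le_top⟩
    refine ⟨ψ + ξ, ⟨⟨_, hL.add hL'⟩, hc.add hc', O ∩ O', hO.inter hO', subset_inter hΓ hΓ',
      fun x hx => by simp [h0 x hx.1, h0' x hx.2]⟩, fun i => ?_, fun i j => ?_⟩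
    · have e : (fun x => (p + q).1 x i - (ψ + ξ) x i)
          = (fun x => p.1 x i - ψ x i) + fun x => q.1 x i - ξ x i := by
        funext x; simp; ring
      rw [e, ← ENNReal.add_halves ε]
      exact (eLpNorm_add_le ((hp.1 i).1.sub (aesm_coord hL i _))
        ((hq.1 i).1.sub (aesm_coord hL' i _)) (by norm_num)).trans (add_le_add (hψ1 i) (hξ1 i))
    · have e : (fun x => (p + q).2 x i j - fderiv ℝ (ψ + ξ) x (EuclideanSpace.single j 1) i)
          =ᵐ[volume.restrict U]
          (fun x => p.2 x i j - fderiv ℝ ψ x (EuclideanSpace.single j 1) i)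
            + fun x => q.2 x i j - fderiv ℝ ξ x (EuclideanSpace.single j 1) i := by
        filter_upwards [ae_restrict_of_ae (hL.ae_differentiableAt (μ := volume)),
          ae_restrict_of_ae (hL'.ae_differentiableAt (μ := volume))] with x h1 h2
        rw [fderiv_add h1 h2]
        simp
        ring
      rw [eLpNorm_congr_ae e, ← ENNReal.add_halves ε]
      exact (eLpNorm_add_le ((hp.2.1 i j).1.sub (aesm_partial ψ i j _))
        ((hq.2.1 i j).1.sub (aesm_partial ξ i j _)) (by norm_num)).trans
        (add_le_add (hψ2 i j) (hξ2 i j))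
  smul_mem' := by
    rintro c p ⟨hp, hp'⟩
    refine ⟨(H1 U).smul_mem c hp, fun ε hε => ?_⟩
    have hk : (0 : ℝ≥0∞) < ε / (‖c‖ₑ + 1) :=
      ENNReal.div_pos hε.ne' (by simp)
    have hkε : ‖c‖ₑ * (ε / (‖c‖ₑ + 1)) ≤ ε := by
      calc ‖c‖ₑ * (ε / (‖c‖ₑ + 1)) ≤ (‖c‖ₑ + 1) * (ε / (‖c‖ₑ + 1)) := by gcongr; simp
        _ ≤ ε := ENNReal.mul_div_le
    obtain ⟨ψ, ⟨⟨L, hL⟩, hc, O, hO, hΓ, h0⟩, hψ1, hψ2⟩ := hp' _ hk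
    refine ⟨c • ψ, ⟨⟨‖c‖₊ * L, ?_⟩, hc.smul_left (f := fun _ => c), O, hO, hΓ,
      fun x hx => by simp [h0 x hx]⟩, fun i => ?_, fun i j => ?_⟩
    · exact (lipschitzWith_smul c).comp hL
    · have e : (fun x => (c • p).1 x i - (c • ψ) x i) = c • fun x => p.1 x i - ψ x i := by
        funext x; simp; ring
      rw [e, eLpNorm_const_smul]
      exact (mul_le_mul_right (hψ1 i) _).trans hkε
    · have e : (fun x => (c • p).2 x i j - fderiv ℝ (c • ψ) x (EuclideanSpace.single j 1) i)
          =ᵐ[volume.restrict U]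
          c • fun x => p.2 x i j - fderiv ℝ ψ x (EuclideanSpace.single j 1) i := by
        filter_upwards [ae_restrict_of_ae (hL.ae_differentiableAt (μ := volume))] with x h1
        rw [fderiv_const_smul h1]
        simp
        ring
      rw [eLpNorm_congr_ae e, eLpNorm_const_smul]
      exact (mul_le_mul_right (hψ2 i j) _).trans hkε

/-- A conforming mesh of `ℝᵈ` by convex quadrilaterals (`d = 2`) or convex hexahedra (`d = 3`), of
mesh size `H`. The vertices of a cell are indexed by the corners of the cube `{0,1}ᵈ`. -/
structure CoarseMesh (d : ℕ) where
  /-- number of cells -/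
  N : ℕ
  /-- number of nodes -/
  M : ℕ
  /-- the nodes -/
  node : Fin M → E d
  /-- the corners of each cell -/
  vertex : Fin N → (Fin d → Bool) → Fin M
  /-- the open cells -/
  cell : Fin N → Set (E d)
  /-- the mesh size -/
  H : ℝ
  H_pos : 0 < H
  node_injective : Function.Injective node
  cell_eq : ∀ i, cell i = interior (convexHull ℝ (range fun c => node (vertex i c)))
  cell_nonempty : ∀ i, (cell i).Nonempty
  /-- the corners `c` with `c k = b` span a facet of the cell -/
  facets : ∀ i k b, ∃ l : E d →ᵃ[ℝ] ℝ,
    (∀ c, c k = b → l (node (vertex i c)) = 0) ∧ ∀ c, c k ≠ b → 0 < l (node (vertex i c))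
  diam_le : ∀ i, Metric.diam (cell i) ≤ H
  cell_disjoint : Pairwise fun i j => Disjoint (cell i) (cell j)
  /-- two closed cells meet in a common (possibly empty) face -/
  conforming : ∀ i j, IsExtreme ℝ (closure (cell i)) (closure (cell i) ∩ closure (cell j))

namespace CoarseMesh

variable {d : ℕ} (T : CoarseMesh d)

/-- The meshed domain. -/
def Ω : Set (E d) := interior (⋃ i, closure (T.cell i))

/-- The oversampled patch `K_{i,m}`: `m` layers of cells around the cell `K_i`. -/
def patch (i : Fin T.N) : ℕ → Set (E d)
  | 0 => T.cell i
  | m + 1 => (⋃ j ∈ {j | (closure (T.cell j) ∩ closure (patch i m)).Nonempty}, T.cell j) ∪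
      closure (patch i m)

/-- Shape regularity and quasi-uniformity with parameter `ρ`. -/
def IsRegular (ρ : ℝ) : Prop := ∀ i, ∃ x, Metric.ball x (ρ * T.H) ⊆ T.cell i

end CoarseMesh

/-- The elasticity problem on a coarse mesh: Lamé coefficients, Dirichlet boundary and a
partition of unity. -/
structure Problem (d : ℕ) extends CoarseMesh d where
  /-- first Lamé coefficient -/
  lam : E d → ℝ
  /-- second Lamé coefficient -/
  mu : E d → ℝ
  lam_measurable : Measurable lam
  mu_measurable : Measurable mu
  lame_bounds : ∃ c C : ℝ, 0 < c ∧
    ∀ x ∈ toCoarseMesh.Ω, c ≤ mu x ∧ mu x ≤ C ∧ 0 ≤ lam x ∧ lam x ≤ C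
  /-- Dirichlet part of the boundary -/
  Γa : Set (E d)
  Γa_closed : IsClosed Γa
  Γa_subset : Γa ⊆ frontier toCoarseMesh.Ω
  /-- partition of unity on the coarse grid, one function per node -/
  χ : Fin M → E d → ℝ
  χ_lipschitz : ∀ n, ∃ L, LipschitzWith L (χ n)
  χ_nonneg : ∀ n, ∀ x ∈ toCoarseMesh.Ω, 0 ≤ χ n x
  χ_sum : ∀ x ∈ toCoarseMesh.Ω, ∑ n, χ n x = 1
  /-- `χ n` lives on the cells that have the node `n` as a vertex -/
  χ_support : ∀ i n, n ∉ range (vertex i) → ∀ x ∈ cell i, χ n x = 0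

namespace Problem

variable {d : ℕ} (P : Problem d)

/-- `H¹_a(Ω)`: the fields in `H¹(Ω; ℝᵈ)` that vanish on `Γ_a`. -/
def H1a : Submodule ℝ (Displ d) := H1Zero P.Ω P.Γa

/-- The strain `ε(v)`. -/
def strain (v : Displ d) (x : E d) : Matrix (Fin d) (Fin d) ℝ :=
  (1 / 2 : ℝ) • (v.2 x + (v.2 x).transpose)

/-- The stress `σ(v) = 2 μ ε(v) + λ (div v) I`. -/
def stress (v : Displ d) (x : E d) : Matrix (Fin d) (Fin d) ℝ :=
  (2 * P.mu x) • strain v x + (P.lam x * (v.2 x).trace) • (1 : Matrix (Fin d) (Fin d) ℝ)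

/-- `∫_S σ(u) : ε(v) dx`. -/
def a (S : Set (E d)) (u v : Displ d) : ℝ :=
  ∫ x in S, ∑ i, ∑ j, P.stress u x i j * strain v x i j

/-- The weight `κ̃ = ∑ₙ (λ + 2 μ) ∇χₙ · ∇χₙ`. -/
def kappa (x : E d) : ℝ := ∑ n, (P.lam x + 2 * P.mu x) * ‖fderiv ℝ (P.χ n) x‖ ^ 2

/-- `∫_S κ̃ u · v dx`. -/
def s (S : Set (E d)) (u v : E d → E d) : ℝ :=
  ∫ x in S, P.kappa x * ∑ i, u x i * v x i

/-- The energy norm on `Ω`. -/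
def aNorm (v : Displ d) : ℝ := √(P.a P.Ω v v)

/-- The `s`-norm on `Ω`. -/
def sNorm (v : E d → E d) : ℝ := √(P.s P.Ω v v)

/-- `(τ, v)` is an eigenpair of the local spectral problem on the cell `K_j` posed in `V`. -/
def IsEigenpair (j : Fin P.N) (V : Submodule ℝ (Displ d)) (τ : ℝ) (v : Displ d) : Prop :=
  v ∈ V ∧ 0 < P.s (P.cell j) v.1 v.1 ∧
    ∀ z ∈ V, P.a (P.cell j) v z = τ * P.s (P.cell j) v.1 z.1

end Problem

/-- The auxiliary space: on each cell `K_j` a snapshot space `V(K_j)` between the restrictions of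
`H¹_a(Ω)` and `H¹(K_j)`, and `s`-orthogonal eigenfunctions for the `g_j` smallest eigenvalues of
the local spectral problem (counted with multiplicity). -/
structure AuxProblem (d : ℕ) extends Problem d where
  /-- snapshot space on each cell -/
  V : Fin N → Submodule ℝ (Displ d)
  H1a_le_V : ∀ j, toProblem.H1a ≤ V j
  V_le_H1 : ∀ j, V j ≤ H1 (cell j)
  /-- number of auxiliary functions on each cell -/
  g : Fin N → ℕ
  /-- eigenvalues -/
  θ : ∀ j, Fin (g j) → ℝ
  /-- eigenfunctions -/
  φ : ∀ j, Fin (g j) → Displ d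
  eigen : ∀ j i, toProblem.IsEigenpair j (V j) (θ j i) (φ j i)
  θ_mono : ∀ j, Monotone (θ j)
  φ_orth : ∀ j, Pairwise fun i k => toProblem.s (cell j) (φ j i).1 (φ j k).1 = 0
  /-- every further eigenvalue is at least as large as the selected ones -/
  θ_least : ∀ j τ v, toProblem.IsEigenpair j (V j) τ v →
    (∀ k, toProblem.s (cell j) v.1 (φ j k).1 = 0) → ∀ i, θ j i ≤ τ

namespace AuxProblem

variable {d : ℕ} (P : AuxProblem d)

/-- The local auxiliary space `V_aux(K_j)`. -/
def Vaux (j : Fin P.N) : Submodule ℝ (E d → E d) :=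
  Submodule.span ℝ (range fun i => (P.φ j i).1)

/-- The local projection `π_j` onto `V_aux(K_j)`. -/
def projLoc (j : Fin P.N) (v : E d → E d) : E d → E d :=
  ∑ i, (P.s (P.cell j) v (P.φ j i).1 / P.s (P.cell j) (P.φ j i).1 (P.φ j i).1) • (P.φ j i).1

/-- The projection `π = ∑_j π_j`, where `π_j v` is extended by zero outside `K_j`. -/
def proj (v : E d → E d) : E d → E d := ∑ j, (P.cell j).indicator (P.projLoc j v)

/-- `W_h = {w ∈ H¹_a(Ω) : π w = 0}`. -/
def Wh : Set P.H1a := {w | P.proj w.1.1 =ᵐ[volume.restrict P.Ω] 0}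

/-- The elements of `W_h` that vanish in `Ω \ S`. -/
def WhOn (S : Set (E d)) : Set P.H1a :=
  {w | w ∈ P.Wh ∧ ∀ᵐ x ∂volume.restrict (P.Ω \ S), w.1.1 x = 0}

/-- The first eigenvalue on `K_j` that does not contribute to the auxiliary space, `θ_j^{g_j+1}`,
as the minimum of the Rayleigh quotient over the `s`-orthogonal complement of `V_aux(K_j)`. -/
def nextEigenvalue (j : Fin P.N) : ℝ :=
  sInf {t | ∃ v ∈ P.V j, (∀ i, P.s (P.cell j) v.1 (P.φ j i).1 = 0) ∧
    P.s (P.cell j) v.1 v.1 = 1 ∧ t = P.a (P.cell j) v v}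

/-- The best constant `A` such that each `q ∈ V_aux(K_j)` is the projection of some `z ∈ H¹_a(Ω)`
that vanishes outside `K_j` and satisfies `‖z‖_a ≤ A ‖q‖_s`. -/
def liftConst : ℝ :=
  sInf {A | 0 ≤ A ∧ ∀ j, ∀ q ∈ P.Vaux j, ∃ z ∈ P.H1a,
    (∀ᵐ x ∂volume.restrict (P.Ω \ P.cell j), z.1 x = 0) ∧
    P.proj z.1 =ᵐ[volume.restrict P.Ω] (P.cell j).indicator q ∧
    P.aNorm z ≤ A * √(P.s (P.cell j) q q)}

end AuxProblem

end CEM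

end

/-!
# Exponential decay and localization in the constrained space `W_h`

Everything is reduced to the energies of single cells. The boundaries of the cells are null sets,
hence integrals over `Ω` and over the patches are sums over cells (`CoarseMesh.setIntegral_eq_sum`),
and a displacement that vanishes almost everywhere on a cell has no energy there
(`grad_ae_eq_zero`). On `W_h` the projection `π` is zero, so the `s`-terms on the left-hand side
vanish and, cell by cell, `Λ ‖w‖_s² ≤ ‖w‖_a²` (`mul_sForm_le_aForm`).

The heart of the matter is a cutoff that stays in `W_h` (`AuxProblem.exists_cutoff`). Given a set
`J` of cells, multiply `w ∈ W_h` by the sum `η` of the functions `χ_n` over the nodes that belong to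
no cell of `J`. Then `η = 0` on `J` and `η = 1` on the cells that do not touch `J`. The weight `κ̃`
controls `|∇η|²`, so that the energy of `η w` on each cell is bounded by that of `w`. On the cells
in between, `π (η w)` need not vanish, but it can be subtracted by lifts that live in single cells,
with constant `liftConst`. (The set defining `liftConst` has to be nonempty for the bound on this
infimum to mean anything: by duality, the test fields on a cell attain all values of the finitely
many moments defining `π`, see `exists_moments` and `liftConst_nonempty`.) Since lifts do not leave
their cells, the cutoff is stable on every single cell, `‖v‖²_{a(K_j)} ≤ K ‖w‖²_{a(K_j)}`.

Three uses of the cutoff, in the abstract setting of `CutoffSystem`, finish the proof.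
* Testing the equation of `w` with its cutoff bounds the energy outside `m + 1` layers by `√K` times
  the energy in the layer `m + 1`, which gives geometric decay with ratio `√K / (1 + √K)`
  (`outer_le`).
* By Galerkin orthogonality the localized solution is as good as the cutoff of `w` to the patch
  (`total_sub_le`).
* Each error is orthogonal to the fields that vanish on its patch, so in the energy of the sum of
  the errors it only meets the sum on one more layer (`total_sum_le`). A volume comparison bounds
  the overlap of these patches by a multiple of `m ^ d` (`CoarseMesh.card_layer_le`).
-/

noncomputable section

namespace CEM

variable {d : ℕ}

/-! ### Sobolev fields -/

theorem lipschitz_coord {ψ : E d → E d} {L} (h : LipschitzWith L ψ) (i : Fin d) :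
    LipschitzWith L fun x => ψ x i := by
  refine LipschitzWith.of_dist_le_mul fun x y => ?_
  refine le_trans ?_ (h.dist_le_mul x y)
  rw [dist_eq_norm, dist_eq_norm, ← PiLp.sub_apply]
  exact PiLp.norm_apply_le _ i

theorem fderiv_coord {ψ : E d → E d} {x : E d} (h : DifferentiableAt ℝ ψ x) (i : Fin d) (v : E d) :
    fderiv ℝ (fun y => ψ y i) x v = fderiv ℝ ψ x v i := by
  have := ((EuclideanSpace.proj (𝕜 := ℝ) i : E d →L[ℝ] ℝ).hasFDerivAt (x := ψ x)).comp x
    h.hasFDerivAt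
  have e : fderiv ℝ (fun y => ψ y i) x = _ := this.fderiv
  rw [e]
  rfl

theorem enorm_integral_mul_le {α : Type*} [MeasurableSpace α] {μ : Measure α} {f g : α → ℝ}
    (hf : AEStronglyMeasurable f μ) (hg : AEStronglyMeasurable g μ) :
    ‖∫ x, f x * g x ∂μ‖ₑ ≤ eLpNorm f 2 μ * eLpNorm g 2 μ := by
  refine (enorm_integral_le_lintegral_enorm _).trans ?_
  rw [← eLpNorm_one_eq_lintegral_enorm]
  have h := eLpNorm_smul_le_mul_eLpNorm (p := 2) (q := 2) (r := 1) (μ := μ) (f := g) (φ := f) hg hf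
  exact h

/-- Integration by parts against a smooth test function, for a Lipschitz field. -/
theorem setIntegral_lipschitz_mul_partial {U : Set (E d)} {ψ : E d → E d} {L}
    (hψ : LipschitzWith L ψ) {η : E d → ℝ} (h1 : ContDiff ℝ ∞ η) (h2 : HasCompactSupport η)
    (h3 : tsupport η ⊆ U) (i j : Fin d) :
    ∫ x in U, ψ x i * fderiv ℝ η x (EuclideanSpace.single j 1) =
      - ∫ x in U, fderiv ℝ ψ x (EuclideanSpace.single j 1) i * η x := by
  have hz : ∀ x, x ∉ U → η x = 0 := fun x hx => image_eq_zero_of_notMem_tsupport fun h => hx (h3 h)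
  have hz' : ∀ x, x ∉ U → fderiv ℝ η x = 0 := fun x hx =>
    image_eq_zero_of_notMem_tsupport fun h => hx (h3 (tsupport_fderiv_subset ℝ h))
  rw [setIntegral_eq_integral_of_forall_compl_eq_zero (fun x hx => by simp [hz' x hx]),
    setIntegral_eq_integral_of_forall_compl_eq_zero (fun x hx => by simp [hz x hx])]
  obtain ⟨C, hC⟩ := ContDiff.lipschitzWith_of_hasCompactSupport (𝕂 := ℝ) h2 h1 (by simp)
  have key := LipschitzWith.integral_lineDeriv_mul_eq (μ := volume) (lipschitz_coord hψ i) hC h2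
    (EuclideanSpace.single j 1)
  have e1 : ∫ x, lineDeriv ℝ (fun x => ψ x i) x (EuclideanSpace.single j 1) * η x =
      ∫ x, fderiv ℝ ψ x (EuclideanSpace.single j 1) i * η x := by
    refine integral_congr_ae ?_
    filter_upwards [hψ.ae_differentiableAt (μ := volume)] with x hx
    have hx' : DifferentiableAt ℝ (fun y => ψ y i) x :=
      (EuclideanSpace.proj (𝕜 := ℝ) i : E d →L[ℝ] ℝ).differentiableAt.comp x hx
    rw [hx'.lineDeriv_eq_fderiv, fderiv_coord hx]
  rw [← e1, key, ← integral_neg]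
  refine integral_congr_ae (Eventually.of_forall fun x => ?_)
  have hx : DifferentiableAt ℝ η x := h1.differentiable (by simp) x
  simp only [hx.lineDeriv_eq_fderiv, map_neg]
  ring

/-- A pair that is a limit, in the norm of `H¹`, of Lipschitz fields and their gradients consists of
a field and its weak gradient. -/
theorem isWeakGrad_of_approx {U : Set (E d)} {p : Displ d}
    (hp1 : ∀ i, MemLp (fun x => p.1 x i) 2 (volume.restrict U))
    (hp2 : ∀ i j, MemLp (fun x => p.2 x i j) 2 (volume.restrict U))
    (happ : ∀ ε : ℝ≥0∞, 0 < ε → ∃ ψ, (∃ L, LipschitzWith L ψ) ∧ IsClose U p ψ ε) :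
    IsWeakGrad U p.1 p.2 := by
  intro η h1 h2 h3 i j
  have hη : MemLp η 2 (volume.restrict U) :=
    (h1.continuous.memLp_of_hasCompactSupport (p := 2) (μ := volume) h2).restrict U
  have hD : MemLp (fun x => fderiv ℝ η x (EuclideanSpace.single j 1)) 2 (volume.restrict U) :=
    ((continuous_partial h1 j).memLp_of_hasCompactSupport (p := 2) (μ := volume)
      (compact_partial h2 j)).restrict U
  set D : E d → ℝ := fun x => fderiv ℝ η x (EuclideanSpace.single j 1) with hDdef
  set K : ℝ≥0∞ := eLpNorm D 2 (volume.restrict U) + eLpNorm η 2 (volume.restrict U) with hK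
  have hKtop : K ≠ ⊤ := ENNReal.add_ne_top.2 ⟨hD.2.ne, hη.2.ne⟩
  set X : ℝ := (∫ x in U, p.1 x i * D x) + ∫ x in U, p.2 x i j * η x with hX
  suffices hX0 : X = 0 by rw [hX] at hX0; linarith
  have main : ∀ r : ℝ, 0 < r → |X| ≤ r * K.toReal := by
    intro r hr
    obtain ⟨ψ, ⟨L, hL⟩, hc1, hc2⟩ := happ (ENNReal.ofReal r) (by simpa using hr)
    have m1 : MemLp (fun x => p.1 x i - ψ x i) 2 (volume.restrict U) :=
      ⟨(hp1 i).1.sub (aesm_coord hL i _), (hc1 i).trans_lt ENNReal.ofReal_lt_top⟩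
    have m2 : MemLp (fun x => p.2 x i j - fderiv ℝ ψ x (EuclideanSpace.single j 1) i) 2
        (volume.restrict U) :=
      ⟨(hp2 i j).1.sub (aesm_partial ψ i j _), (hc2 i j).trans_lt ENNReal.ofReal_lt_top⟩
    have ibp := setIntegral_lipschitz_mul_partial hL h1 h2 h3 i j
    have eX : X = (∫ x in U, (p.1 x i - ψ x i) * D x) +
        ∫ x in U, (p.2 x i j - fderiv ℝ ψ x (EuclideanSpace.single j 1) i) * η x := by
      have i1 : Integrable (fun x => p.1 x i * D x) (volume.restrict U) := (hp1 i).integrable_mul hD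
      have i2 : Integrable (fun x => (p.1 x i - ψ x i) * D x) (volume.restrict U) :=
        m1.integrable_mul hD
      have i3 : Integrable (fun x => p.2 x i j * η x) (volume.restrict U) :=
        (hp2 i j).integrable_mul hη
      have i4 : Integrable (fun x => (p.2 x i j -
          fderiv ℝ ψ x (EuclideanSpace.single j 1) i) * η x) (volume.restrict U) :=
        m2.integrable_mul hη
      have j1 : Integrable (fun x => ψ x i * D x) (volume.restrict U) := by
        refine (i1.sub i2).congr (Eventually.of_forall fun x => ?_)
        simp only [Pi.sub_apply]
        ring
      have j2 : Integrable (fun x => fderiv ℝ ψ x (EuclideanSpace.single j 1) i * η x)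
          (volume.restrict U) := by
        refine (i3.sub i4).congr (Eventually.of_forall fun x => ?_)
        simp only [Pi.sub_apply]
        ring
      simp only [sub_mul]
      rw [integral_sub i1 j1, integral_sub i3 j2, ibp, hX]
      ring
    have b1 := enorm_integral_mul_le m1.1 hD.1
    have b2 := enorm_integral_mul_le m2.1 hη.1
    have b : ‖X‖ₑ ≤ ENNReal.ofReal r * K := by
      rw [eX, hK, mul_add]
      refine (enorm_add_le _ _).trans (add_le_add (b1.trans ?_) (b2.trans ?_))
      · exact mul_le_mul_left (hc1 i) _
      · exact mul_le_mul_left (hc2 i j) _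
    have := ENNReal.toReal_mono (ENNReal.mul_ne_top ENNReal.ofReal_ne_top hKtop) b
    rwa [ENNReal.toReal_mul, ENNReal.toReal_ofReal hr.le, toReal_enorm, Real.norm_eq_abs] at this
  by_contra hne
  have hpos : 0 < |X| := abs_pos.2 hne
  have hK0 : 0 ≤ K.toReal := ENNReal.toReal_nonneg
  have := main (|X| / (2 * (K.toReal + 1))) (by positivity)
  rw [div_mul_eq_mul_div, le_div_iff₀ (by positivity)] at this
  nlinarith

/-- A field together with its classical gradient. -/
def ofField (ψ : E d → E d) : Displ d :=
  (ψ, fun x => Matrix.of fun i j => fderiv ℝ ψ x (EuclideanSpace.single j 1) i)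

theorem abs_fderiv_apply_single_le {η : E d → ℝ} {L} (hη : LipschitzWith L η) (x : E d)
    (j : Fin d) : |fderiv ℝ η x (EuclideanSpace.single j 1)| ≤ L := by
  have := (fderiv ℝ η x).le_opNorm (EuclideanSpace.single j 1)
  simp only [Real.norm_eq_abs, PiLp.norm_single, norm_one, mul_one] at this
  exact this.trans (norm_fderiv_le_of_lipschitz ℝ hη)

theorem IsAdmissible.ofField_mem {U Γ : Set (E d)} {ψ : E d → E d} (h : IsAdmissible Γ ψ) :
    ofField ψ ∈ H1Zero U Γ := by
  obtain ⟨⟨L, hL⟩, hc, -⟩ := id h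
  have m1 : ∀ i, MemLp (fun x => (ofField ψ).1 x i) 2 (volume.restrict U) := fun i =>
    ((lipschitz_coord hL i).continuous.memLp_of_hasCompactSupport (p := 2) (μ := volume)
      (hc.comp_left (g := fun y : E d => y i) rfl)).restrict U
  have m2 : ∀ i j, MemLp (fun x => (ofField ψ).2 x i j) 2 (volume.restrict U) := by
    intro i j
    have hsupp : HasCompactSupport fun x => fderiv ℝ ψ x (EuclideanSpace.single j 1) i :=
      (hc.fderiv_apply (𝕜 := ℝ) (EuclideanSpace.single j 1)).comp_left
        (g := fun y : E d => y i) rfl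
    refine MemLp.restrict U ?_
    refine (memLp_top_of_bound (aesm_partial ψ i j volume) L
      (Eventually.of_forall fun x => ?_)).mono_exponent_of_measure_support_ne_top
      (s := tsupport fun x => fderiv ℝ ψ x (EuclideanSpace.single j 1) i)
      (fun x hx => image_eq_zero_of_notMem_tsupport
        (f := fun x => fderiv ℝ ψ x (EuclideanSpace.single j 1) i) hx) hsupp.measure_lt_top.ne le_top
    calc ‖fderiv ℝ ψ x (EuclideanSpace.single j 1) i‖
        ≤ ‖fderiv ℝ ψ x (EuclideanSpace.single j 1)‖ := PiLp.norm_apply_le _ i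
      _ ≤ ‖fderiv ℝ ψ x‖ * ‖(EuclideanSpace.single j 1 : E d)‖ := ContinuousLinearMap.le_opNorm _ _
      _ ≤ L := by
        rw [PiLp.norm_single, norm_one, mul_one]
        exact norm_fderiv_le_of_lipschitz ℝ hL
  have hcl : ∀ ε : ℝ≥0∞, IsClose U (ofField ψ) ψ ε :=
    fun ε => ⟨fun i => by simp [ofField], fun i j => by simp [ofField]⟩
  exact ⟨⟨m1, m2, isWeakGrad_of_approx m1 m2 fun ε _ => ⟨ψ, ⟨L, hL⟩, hcl ε⟩⟩,
    fun ε _ => ⟨ψ, h, hcl ε⟩⟩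

/-- The product of a displacement with a scalar function, with its gradient given by the product
rule. -/
def cutoff (η : E d → ℝ) (p : Displ d) : Displ d :=
  (fun x => η x • p.1 x,
   fun x => Matrix.of fun i j =>
    η x * p.2 x i j + p.1 x i * fderiv ℝ η x (EuclideanSpace.single j 1))

theorem lipschitz_smul_of_compact {η : E d → ℝ} {ψ : E d → E d} {K L}
    (hη : LipschitzWith K η) (hψ : LipschitzWith L ψ) (hc : HasCompactSupport ψ) :
    ∃ M, LipschitzWith M fun x => η x • ψ x := by
  obtain ⟨A, hA⟩ := hc.exists_bound_of_continuousOn hη.continuous.continuousOn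
  obtain ⟨B, hB⟩ := hψ.continuous.bounded_above_of_compact_support hc
  have hB0 : 0 ≤ B := (norm_nonneg _).trans (hB 0)
  have half : ∀ x y, x ∈ tsupport ψ →
      ‖η x • ψ x - η y • ψ y‖ ≤ (|A| * L + K * B) * dist x y := by
    intro x y hx
    have e : η x • ψ x - η y • ψ y = η x • (ψ x - ψ y) + (η x - η y) • ψ y := by
      rw [smul_sub, sub_smul]; abel
    rw [e]
    refine (norm_add_le _ _).trans ?_
    rw [norm_smul, norm_smul, ← dist_eq_norm (ψ x), ← dist_eq_norm (η x)]
    have a1 := hA x hx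
    have a2 := hψ.dist_le_mul x y
    have a3 := hη.dist_le_mul x y
    have a4 := hB y
    calc ‖η x‖ * dist (ψ x) (ψ y) + dist (η x) (η y) * ‖ψ y‖
        ≤ |A| * (L * dist x y) + (K * dist x y) * B := by
          gcongr
          exact a1.trans (le_abs_self A)
      _ = _ := by ring
  refine ⟨(|A| * L + K * B).toNNReal, LipschitzWith.of_dist_le_mul fun x y => ?_⟩
  rw [Real.coe_toNNReal _ (by positivity), dist_eq_norm]
  by_cases hx : x ∈ tsupport ψ
  · exact half x y hx
  by_cases hy : y ∈ tsupport ψ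
  · rw [norm_sub_rev, dist_comm]
    exact half y x hy
  · simp only [image_eq_zero_of_notMem_tsupport hx, image_eq_zero_of_notMem_tsupport hy, smul_zero,
      sub_zero, norm_zero]
    positivity

theorem memLp_mul_of_bound {α : Type*} [MeasurableSpace α] {μ : Measure α} {f g : α → ℝ} {c : ℝ}
    (hf : AEStronglyMeasurable f μ) (hb : ∀ᵐ x ∂μ, |f x| ≤ c) (hg : MemLp g 2 μ) :
    MemLp (fun x => f x * g x) 2 μ :=
  hg.of_le_mul (c := c) (hf.mul hg.1) (hb.mono fun x hx => by
    rw [norm_mul]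
    exact mul_le_mul_of_nonneg_right hx (norm_nonneg _))

theorem eLpNorm_mul_le_of_bound {α : Type*} [MeasurableSpace α] {μ : Measure α} {f g : α → ℝ} {c : ℝ}
    (hb : ∀ᵐ x ∂μ, |f x| ≤ c) :
    eLpNorm (fun x => f x * g x) 2 μ ≤ ENNReal.ofReal c * eLpNorm g 2 μ := by
  refine eLpNorm_le_mul_eLpNorm_of_ae_le_mul (hb.mono fun x hx => ?_) 2
  rw [norm_mul]
  exact mul_le_mul_of_nonneg_right hx (norm_nonneg _)

/-- Multiplication by a Lipschitz function with values in `[-1, 1]` preserves `H¹` and the boundary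
condition. -/
theorem cutoff_mem_H1Zero {U Γ : Set (E d)} (hU : MeasurableSet U) {η : E d → ℝ} {L}
    (hη : LipschitzWith L η) (hb : ∀ x ∈ U, |η x| ≤ 1) {p : Displ d} (hp : p ∈ H1Zero U Γ) :
    cutoff η p ∈ H1Zero U Γ := by
  obtain ⟨⟨hp1, hp2, -⟩, happ⟩ := hp
  have hbae : ∀ᵐ x ∂volume.restrict U, |η x| ≤ 1 := (ae_restrict_iff' hU).2 (Eventually.of_forall hb)
  have hηm : AEStronglyMeasurable η (volume.restrict U) := hη.continuous.aestronglyMeasurable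
  have hDm : ∀ j : Fin d, AEStronglyMeasurable
      (fun x => fderiv ℝ η x (EuclideanSpace.single j 1)) (volume.restrict U) := fun j =>
    (measurable_fderiv_apply_const ℝ η (EuclideanSpace.single j 1)).aestronglyMeasurable
  have hDb : ∀ j : Fin d, ∀ᵐ x ∂volume.restrict U,
      |fderiv ℝ η x (EuclideanSpace.single j 1)| ≤ L := fun j =>
    Eventually.of_forall fun x => abs_fderiv_apply_single_le hη x j
  have m1 : ∀ i, MemLp (fun x => (cutoff η p).1 x i) 2 (volume.restrict U) := fun i =>
    memLp_mul_of_bound hηm hbae (hp1 i)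
  have m2 : ∀ i j, MemLp (fun x => (cutoff η p).2 x i j) 2 (volume.restrict U) := by
    intro i j
    refine ((memLp_mul_of_bound hηm hbae (hp2 i j)).add
      (memLp_mul_of_bound (hDm j) (hDb j) (hp1 i))).ae_eq (Eventually.of_forall fun x => ?_)
    simp [cutoff, mul_comm]
  have app : ∀ ε : ℝ≥0∞, 0 < ε →
      ∃ ψ, IsAdmissible Γ ψ ∧ IsClose U (cutoff η p) ψ ε := by
    intro ε hε
    have hk : (0 : ℝ≥0∞) < ε / (1 + L) := ENNReal.div_pos hε.ne' (by simp)
    obtain ⟨ψ, ⟨⟨M, hM⟩, hc, O, hO, hΓ, h0⟩, hψ1, hψ2⟩ := happ _ hk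
    have hkε : (1 + L) * (ε / (1 + L)) ≤ ε := ENNReal.mul_div_le
    refine ⟨fun x => η x • ψ x, ⟨lipschitz_smul_of_compact hη hM hc, hc.smul_left (f := η), O, hO,
      hΓ, fun x hx => by simp [h0 x hx]⟩, fun i => ?_, fun i j => ?_⟩
    · have e : (fun x => (cutoff η p).1 x i - (η x • ψ x) i) =
          fun x => η x * (p.1 x i - ψ x i) := by
        funext x
        simp [cutoff, mul_sub]
      rw [e]
      refine (eLpNorm_mul_le_of_bound hbae).trans (le_trans ?_ hkε)
      rw [ENNReal.ofReal_one]
      exact mul_le_mul' le_self_add (hψ1 i)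
    · have e : (fun x => (cutoff η p).2 x i j -
            fderiv ℝ (fun x => η x • ψ x) x (EuclideanSpace.single j 1) i)
          =ᵐ[volume.restrict U]
          (fun x => η x * (p.2 x i j - fderiv ℝ ψ x (EuclideanSpace.single j 1) i)) +
          fun x => fderiv ℝ η x (EuclideanSpace.single j 1) * (p.1 x i - ψ x i) := by
        filter_upwards [ae_restrict_of_ae (hM.ae_differentiableAt (μ := volume)),
          ae_restrict_of_ae (hη.ae_differentiableAt (μ := volume))] with x h1 h2
        rw [fderiv_fun_smul h2 h1]
        simp [cutoff]
        ring
      rw [eLpNorm_congr_ae e]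
      refine (eLpNorm_add_le (hηm.mul ((hp2 i j).1.sub (aesm_partial ψ i j _)))
        ((hDm j).mul ((hp1 i).1.sub (aesm_coord hM i _))) (by norm_num)).trans (le_trans ?_ hkε)
      rw [add_mul, one_mul]
      refine add_le_add ?_ ?_
      · refine (eLpNorm_mul_le_of_bound hbae).trans ?_
        rw [ENNReal.ofReal_one, one_mul]
        exact hψ2 i j
      · refine (eLpNorm_mul_le_of_bound (hDb j)).trans ?_
        rw [ENNReal.ofReal_coe_nnreal]
        exact mul_le_mul_right (hψ1 i) _
  refine ⟨⟨m1, m2, isWeakGrad_of_approx m1 m2 fun ε hε => ?_⟩, app⟩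
  obtain ⟨ψ, hψ, hcl⟩ := app ε hε
  exact ⟨ψ, hψ.1, hcl⟩

/-- The weak gradient of a field vanishes on every open set on which the field vanishes. -/
theorem grad_ae_eq_zero {U V : Set (E d)} (hV : IsOpen V) (hVU : V ⊆ U) {p : Displ d} (hp : p ∈ H1 U)
    (h0 : ∀ᵐ x ∂volume.restrict V, p.1 x = 0) (i j : Fin d) :
    ∀ᵐ x ∂volume.restrict V, p.2 x i j = 0 := by
  obtain ⟨hp1, hp2, hp3⟩ := hp
  rw [ae_restrict_iff' hV.measurableSet] at h0 ⊢
  refine hV.ae_eq_zero_of_integral_contDiff_smul_eq_zero ?_ fun η h1 h2 h3 => ?_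
  · have : MemLp (fun x => p.2 x i j) 2 (volume.restrict V) :=
      (hp2 i j).mono_measure (Measure.restrict_mono hVU le_rfl)
    exact (locallyIntegrableOn_of_locallyIntegrable_restrict
      (this.locallyIntegrable (by norm_num)))
  · have key := hp3 η h1 h2 (h3.trans hVU) i j
    have hz : ∀ x, x ∉ U → η x = 0 := fun x hx =>
      image_eq_zero_of_notMem_tsupport fun h => hx (hVU (h3 h))
    have l0 : ∫ x in U, p.1 x i * fderiv ℝ η x (EuclideanSpace.single j 1) = 0 := by
      refine integral_eq_zero_of_ae (ae_restrict_of_ae ?_)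
      filter_upwards [h0] with x hx
      by_cases hxV : x ∈ V
      · simp [hx hxV]
      · have : fderiv ℝ η x = 0 := image_eq_zero_of_notMem_tsupport fun h =>
          hxV (h3 (tsupport_fderiv_subset ℝ h))
        simp [this]
    rw [l0, setIntegral_eq_integral_of_forall_compl_eq_zero (fun x hx => by simp [hz x hx])] at key
    simp only [smul_eq_mul, mul_comm (η _)]
    linarith

/-! ### Geometry of the mesh -/

open Classical in
/-- The indices reached from `i` in at most `m` steps along the reflexive relation `r`. -/
def layer {ι : Type*} [Fintype ι] (r : ι → ι → Prop) (i : ι) : ℕ → Finset ι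
  | 0 => {i}
  | m + 1 => Finset.univ.filter fun j => ∃ k ∈ layer r i m, r j k

theorem mem_layer_zero {ι : Type*} [Fintype ι] {r : ι → ι → Prop} {i j : ι} :
    j ∈ layer r i 0 ↔ j = i := by
  simp [layer]

theorem mem_layer_succ {ι : Type*} [Fintype ι] {r : ι → ι → Prop} {i j : ι} {m : ℕ} :
    j ∈ layer r i (m + 1) ↔ ∃ k ∈ layer r i m, r j k := by
  simp [layer]

theorem layer_subset_succ {ι : Type*} [Fintype ι] {r : ι → ι → Prop} (hr : ∀ i, r i i) (i : ι)
    (m : ℕ) : layer r i m ⊆ layer r i (m + 1) := fun j hj => mem_layer_succ.2 ⟨j, hj, hr j⟩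

theorem self_mem_layer {ι : Type*} [Fintype ι] {r : ι → ι → Prop} (hr : ∀ i, r i i) (i : ι)
    (m : ℕ) : i ∈ layer r i m := by
  induction m with
  | zero => exact mem_layer_zero.2 rfl
  | succ m ih => exact layer_subset_succ hr i m ih

namespace CoarseMesh

variable (T : CoarseMesh d)

/-- Two cells touch if their closures meet. -/
def Touch (j k : Fin T.N) : Prop := (closure (T.cell j) ∩ closure (T.cell k)).Nonempty

theorem touch_self (j : Fin T.N) : T.Touch j j := by
  simpa [Touch] using T.cell_nonempty j

theorem isOpen_cell (j : Fin T.N) : IsOpen (T.cell j) := by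
  rw [T.cell_eq j]
  exact isOpen_interior

theorem convex_cell (j : Fin T.N) : Convex ℝ (T.cell j) := by
  rw [T.cell_eq j]
  exact (convex_convexHull ℝ _).interior

theorem isBounded_cell (j : Fin T.N) : Bornology.IsBounded (T.cell j) := by
  rw [T.cell_eq j]
  exact (isBounded_convexHull.2 (finite_range _).isBounded).subset interior_subset

theorem node_mem_closure (j : Fin T.N) (c : Fin d → Bool) :
    T.node (T.vertex j c) ∈ closure (T.cell j) := by
  have hne : (interior (convexHull ℝ (range fun c => T.node (T.vertex j c)))).Nonempty := by
    rw [← T.cell_eq j]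
    exact T.cell_nonempty j
  rw [T.cell_eq j,
    (convex_convexHull ℝ _).closure_interior_eq_closure_of_nonempty_interior hne]
  exact subset_closure (subset_convexHull ℝ _ (mem_range_self c))

theorem cell_subset_Ω (j : Fin T.N) : T.cell j ⊆ T.Ω :=
  interior_maximal (subset_closure.trans (subset_iUnion (fun i => closure (T.cell i)) j))
    (T.isOpen_cell j)

theorem isOpen_Ω : IsOpen T.Ω := isOpen_interior

theorem disjoint_closure {j k : Fin T.N} (h : j ≠ k) : Disjoint (T.cell j) (closure (T.cell k)) :=
  (T.cell_disjoint h).closure_right (T.isOpen_cell j)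

theorem closure_cell_ae_eq (j : Fin T.N) : closure (T.cell j) =ᵐ[volume] T.cell j := by
  have h : volume (frontier (T.cell j)) = 0 := (T.convex_cell j).addHaar_frontier _
  rw [closure_eq_self_union_frontier]
  exact union_ae_eq_left_of_ae_eq_empty (ae_eq_empty.2 h)

/-- A set between a union of open cells and the union of the closed ones agrees with the first up to
a null set, as boundaries of convex sets are null sets. -/
theorem ae_eq_biUnion {S : Set (E d)} {J : Finset (Fin T.N)} (h1 : ⋃ j ∈ J, T.cell j ⊆ S)
    (h2 : S ⊆ ⋃ j ∈ J, closure (T.cell j)) : S =ᵐ[volume] ⋃ j ∈ J, T.cell j := by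
  have h : (⋃ j ∈ J, closure (T.cell j) : Set (E d)) =ᵐ[volume] ⋃ j ∈ J, T.cell j :=
    Filter.EventuallyEq.countable_bUnion J.countable_toSet fun j _ => T.closure_cell_ae_eq j
  exact (h2.eventuallyLE.trans h.le).antisymm h1.eventuallyLE

theorem setIntegral_eq_sum {S : Set (E d)} {J : Finset (Fin T.N)} (h1 : ⋃ j ∈ J, T.cell j ⊆ S)
    (h2 : S ⊆ ⋃ j ∈ J, closure (T.cell j)) {f : E d → ℝ}
    (hf : ∀ j, IntegrableOn f (T.cell j)) : ∫ x in S, f x = ∑ j ∈ J, ∫ x in T.cell j, f x := by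
  rw [setIntegral_congr_set (T.ae_eq_biUnion h1 h2)]
  exact integral_biUnion_finset J (fun j _ => (T.isOpen_cell j).measurableSet)
    (fun i _ j _ hij => T.cell_disjoint hij) fun j _ => hf j

theorem Ω_subset : T.Ω ⊆ ⋃ j ∈ Finset.univ, closure (T.cell j) := by
  simpa [Ω] using interior_subset

theorem iUnion_subset_Ω (J : Finset (Fin T.N)) : ⋃ j ∈ J, T.cell j ⊆ T.Ω :=
  iUnion₂_subset fun j _ => T.cell_subset_Ω j

theorem ae_restrict_Ω_iff {p : E d → Prop} :
    (∀ᵐ x ∂volume.restrict T.Ω, p x) ↔ ∀ j, ∀ᵐ x ∂volume.restrict (T.cell j), p x := by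
  rw [Measure.restrict_congr_set (T.ae_eq_biUnion (T.iUnion_subset_Ω Finset.univ) T.Ω_subset)]
  simp

theorem closure_patch (i : Fin T.N) (m : ℕ) :
    closure (T.patch i m) = ⋃ j ∈ layer T.Touch i m, closure (T.cell j) := by
  induction m with
  | zero => simp [patch, layer]
  | succ m ih =>
    have hJ : ∀ j, (closure (T.cell j) ∩ closure (T.patch i m)).Nonempty ↔
        j ∈ layer T.Touch i (m + 1) := by
      intro j
      rw [mem_layer_succ, ih, inter_iUnion₂]
      simp [nonempty_iUnion, Touch]
    have e : T.patch i (m + 1) = (⋃ j ∈ layer T.Touch i (m + 1), T.cell j) ∪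
        closure (T.patch i m) := by
      simp only [patch, mem_ofPred_eq, hJ]
    rw [e, closure_union, closure_closure, Finset.closure_biUnion, ih, union_eq_left]
    exact biUnion_subset_biUnion_left (layer_subset_succ T.touch_self i m)

theorem cell_subset_patch {i j : Fin T.N} {m : ℕ} (h : j ∈ layer T.Touch i m) :
    T.cell j ⊆ T.patch i m := by
  cases m with
  | zero => rw [mem_layer_zero.1 h, patch]
  | succ m =>
    obtain ⟨k, hk, x, hx1, hx2⟩ := mem_layer_succ.1 h
    rw [patch]
    refine fun z hz => Or.inl (mem_biUnion (x := j) ?_ hz)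
    refine ⟨x, hx1, ?_⟩
    rw [closure_patch]
    exact mem_biUnion hk hx2

theorem disjoint_patch {i j : Fin T.N} {m : ℕ} (h : j ∉ layer T.Touch i m) :
    Disjoint (T.cell j) (T.patch i m) := by
  refine Disjoint.mono_right subset_closure ?_
  rw [closure_patch, disjoint_iUnion₂_right]
  exact fun k hk => T.disjoint_closure fun e => h (e ▸ hk)

theorem dist_le_of_mem_layer {i j : Fin T.N} {m : ℕ} (h : j ∈ layer T.Touch i m) {x y : E d}
    (hx : x ∈ closure (T.cell i)) (hy : y ∈ closure (T.cell j)) : dist x y ≤ (m + 1) * T.H := by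
  have hd : ∀ k, ∀ x ∈ closure (T.cell k), ∀ y ∈ closure (T.cell k), dist x y ≤ T.H := by
    intro k x hx y hy
    refine (Metric.dist_le_diam_of_mem (T.isBounded_cell k).closure hx hy).trans ?_
    rw [Metric.diam_closure]
    exact T.diam_le k
  induction m generalizing j y with
  | zero =>
    rw [mem_layer_zero.1 h] at hy
    simpa using hd i x hx y hy
  | succ m ih =>
    obtain ⟨k, hk, z, hz1, hz2⟩ := mem_layer_succ.1 h
    have h1 := ih hk hz2
    have h2 := hd j z hz1 y hy
    have := dist_triangle x z y
    push_cast
    linarith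

/-- A cell belongs to boundedly many patches: the centres of the patches contain disjoint balls of
radius `ρ H` that lie in one ball of radius `(m + 1) H`. -/
theorem card_layer_le [Nontrivial (E d)] {ρ : ℝ} (hρ : 0 < ρ) (hT : T.IsRegular ρ) (m : ℕ)
    (j : Fin T.N) (I : Finset (Fin T.N)) (hI : ∀ i ∈ I, j ∈ layer T.Touch i m) :
    (I.card : ℝ) ≤ ((m + 1) / ρ) ^ d := by
  choose x hx using hT
  obtain ⟨y, hy⟩ := T.cell_nonempty j
  have hH := T.H_pos
  have hsub : ⋃ i ∈ I, Metric.ball (x i) (ρ * T.H) ⊆ Metric.closedBall y ((m + 1) * T.H) :=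
    iUnion₂_subset fun i hi z hz =>
      T.dist_le_of_mem_layer (hI i hi) (subset_closure (hx i hz)) (subset_closure hy)
  have hvol := measure_mono (μ := volume) hsub
  rw [measure_biUnion_finset
    (fun i _ k _ hik => (T.cell_disjoint hik).mono (hx i) (hx k))
    (fun i _ => Metric.isOpen_ball.measurableSet)] at hvol
  simp only [Measure.addHaar_ball volume _ (by positivity : 0 ≤ ρ * T.H),
    Measure.addHaar_closedBall volume _ (by positivity : 0 ≤ ((m : ℝ) + 1) * T.H),
    finrank_euclideanSpace_fin, Finset.sum_const, nsmul_eq_mul] at hvol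
  rw [← mul_assoc, ENNReal.mul_le_mul_iff_left (Metric.measure_ball_pos _ _ one_pos).ne'
    measure_ball_lt_top.ne, ← ENNReal.ofReal_natCast, ← ENNReal.ofReal_mul (by positivity),
    ENNReal.ofReal_le_ofReal_iff (by positivity), mul_pow, mul_pow, ← mul_assoc] at hvol
  rw [div_pow, le_div_iff₀ (by positivity)]
  exact le_of_mul_le_mul_right hvol (by positivity)

end CoarseMesh

/-! ### The energy form and the weighted `L²` form -/

/-- The pointwise elastic energy `2 m (sym G : sym F) + l (tr G) (tr F)` of two gradients. -/
def pairing (m l : ℝ) (G F : Matrix (Fin d) (Fin d) ℝ) : ℝ :=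
  2 * m * (∑ i, ∑ j, (G i j + G j i) / 2 * ((F i j + F j i) / 2)) + l * G.trace * F.trace

theorem pairing_comm (m l : ℝ) (G F : Matrix (Fin d) (Fin d) ℝ) :
    pairing m l G F = pairing m l F G := by
  simp only [pairing, mul_comm]
  ring

theorem pairing_add (m l : ℝ) (G G' F : Matrix (Fin d) (Fin d) ℝ) :
    pairing m l (G + G') F = pairing m l G F + pairing m l G' F := by
  have h : (∑ i, ∑ j, ((G + G') i j + (G + G') j i) / 2 * ((F i j + F j i) / 2)) =
      (∑ i, ∑ j, (G i j + G j i) / 2 * ((F i j + F j i) / 2)) +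
      ∑ i, ∑ j, (G' i j + G' j i) / 2 * ((F i j + F j i) / 2) := by
    simp only [← Finset.sum_add_distrib, Matrix.add_apply]
    refine Finset.sum_congr rfl fun i _ => Finset.sum_congr rfl fun j _ => ?_
    ring
  rw [pairing, h, Matrix.trace_add, pairing, pairing]
  ring

theorem pairing_smul (m l c : ℝ) (G F : Matrix (Fin d) (Fin d) ℝ) :
    pairing m l (c • G) F = c * pairing m l G F := by
  have h : (∑ i, ∑ j, ((c • G) i j + (c • G) j i) / 2 * ((F i j + F j i) / 2)) =
      c * ∑ i, ∑ j, (G i j + G j i) / 2 * ((F i j + F j i) / 2) := by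
    simp only [Finset.mul_sum, Matrix.smul_apply, smul_eq_mul]
    refine Finset.sum_congr rfl fun i _ => Finset.sum_congr rfl fun j _ => ?_
    ring
  rw [pairing, h, Matrix.trace_smul, pairing, smul_eq_mul]
  ring

theorem pairing_self_nonneg {m l : ℝ} (hm : 0 ≤ m) (hl : 0 ≤ l) (G : Matrix (Fin d) (Fin d) ℝ) :
    0 ≤ pairing m l G G := by
  have h : 0 ≤ ∑ i, ∑ j, (G i j + G j i) / 2 * ((G i j + G j i) / 2) :=
    Finset.sum_nonneg fun i _ => Finset.sum_nonneg fun j _ => mul_self_nonneg _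
  have h2 : 0 ≤ l * G.trace * G.trace := by
    rw [mul_assoc]
    exact mul_nonneg hl (mul_self_nonneg _)
  rw [pairing]
  positivity

theorem pairing_add_self_le {m l : ℝ} (hm : 0 ≤ m) (hl : 0 ≤ l) (G F : Matrix (Fin d) (Fin d) ℝ) :
    pairing m l (G + F) (G + F) ≤ 2 * pairing m l G G + 2 * pairing m l F F := by
  have key : ∀ G F : Matrix (Fin d) (Fin d) ℝ, pairing m l (G + F) (G + F) =
      pairing m l G G + 2 * pairing m l F G + pairing m l F F := by
    intro G F
    rw [pairing_add, pairing_comm m l G (G + F), pairing_comm m l F (G + F), pairing_add,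
      pairing_add, pairing_comm m l G F]
    ring
  have h := pairing_self_nonneg hm hl (G + (-1 : ℝ) • F)
  rw [key, pairing_smul, pairing_smul, pairing_comm m l F ((-1 : ℝ) • F), pairing_smul] at h
  rw [key]
  linarith

/-- The energy of the rank one gradient `w ⊗ b`. -/
theorem pairing_vecMulVec_le {m l : ℝ} (hm : 0 ≤ m) (hl : 0 ≤ l) (w b : Fin d → ℝ) :
    pairing m l (Matrix.vecMulVec w b) (Matrix.vecMulVec w b) ≤
      (l + 2 * m) * ((∑ i, w i ^ 2) * ∑ j, b j ^ 2) := by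
  have h1 : ∑ i, ∑ j, (w i * b j + w j * b i) / 2 * ((w i * b j + w j * b i) / 2) ≤
      (∑ i, w i ^ 2) * ∑ j, b j ^ 2 := by
    calc ∑ i, ∑ j, (w i * b j + w j * b i) / 2 * ((w i * b j + w j * b i) / 2)
        ≤ ∑ i, ∑ j, (w i ^ 2 * b j ^ 2 / 2 + w j ^ 2 * b i ^ 2 / 2) := by
          refine Finset.sum_le_sum fun i _ => Finset.sum_le_sum fun j _ => ?_
          nlinarith [sq_nonneg (w i * b j - w j * b i)]
      _ = (∑ i, ∑ j, w i ^ 2 * b j ^ 2 / 2) + ∑ j, ∑ i, w j ^ 2 * b i ^ 2 / 2 := by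
          simp only [Finset.sum_add_distrib]
          congr 1
          exact Finset.sum_comm
      _ = (∑ i, w i ^ 2) * ∑ j, b j ^ 2 := by
          rw [Finset.sum_mul_sum]
          simp only [← Finset.sum_div]
          ring
  have h2 : (∑ i, w i * b i) ^ 2 ≤ (∑ i, w i ^ 2) * ∑ j, b j ^ 2 :=
    Finset.sum_mul_sq_le_sq_mul_sq _ _ _
  have e : (Matrix.vecMulVec w b).trace = ∑ i, w i * b i := by
    simp [Matrix.trace, Matrix.vecMulVec_apply]
  rw [pairing, e]
  simp only [Matrix.vecMulVec_apply]
  have h3 := mul_le_mul_of_nonneg_left h1 (mul_nonneg zero_le_two hm)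
  have h4 := mul_le_mul_of_nonneg_left h2 hl
  nlinarith

/-- Square integrable vector fields on `U`. -/
def L2Field (U : Set (E d)) : Submodule ℝ (E d → E d) where
  carrier := {f | ∀ i, MemLp (fun x => f x i) 2 (volume.restrict U)}
  zero_mem' := fun i => by simp
  add_mem' := fun hf hg i => (hf i).add (hg i)
  smul_mem' := fun c f hf i => (hf i).const_mul c

theorem L2Field_mono {U V : Set (E d)} (h : U ⊆ V) : L2Field V ≤ L2Field U := fun _ hf i =>
  (hf i).mono_measure (Measure.restrict_mono h le_rfl)

namespace Problem

variable (P : Problem d)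

theorem integrand_eq (u v : Displ d) (x : E d) :
    ∑ i, ∑ j, P.stress u x i j * strain v x i j = pairing (P.mu x) (P.lam x) (u.2 x) (v.2 x) := by
  have h : ∀ i j, P.stress u x i j * strain v x i j =
      2 * P.mu x * ((u.2 x i j + u.2 x j i) / 2 * ((v.2 x i j + v.2 x j i) / 2)) +
      if i = j then P.lam x * (u.2 x).trace * v.2 x i i else 0 := by
    intro i j
    simp only [stress, strain, Matrix.add_apply, Matrix.smul_apply, Matrix.transpose_apply,
      Matrix.one_apply, smul_eq_mul]
    split_ifs with hij
    · subst hij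
      ring
    · ring
  simp only [h, Finset.sum_add_distrib, ← Finset.mul_sum, Finset.sum_ite_eq, Finset.mem_univ,
    if_true, pairing]
  rfl

theorem a_eq (S : Set (E d)) (u v : Displ d) :
    P.a S u v = ∫ x in S, pairing (P.mu x) (P.lam x) (u.2 x) (v.2 x) := by
  simp only [a, integrand_eq]

theorem mu_nonneg {x : E d} (hx : x ∈ P.Ω) : 0 ≤ P.mu x := by
  obtain ⟨c, C, hc, h⟩ := P.lame_bounds
  exact hc.le.trans (h x hx).1

theorem lam_nonneg {x : E d} (hx : x ∈ P.Ω) : 0 ≤ P.lam x := by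
  obtain ⟨c, C, hc, h⟩ := P.lame_bounds
  exact (h x hx).2.2.1

theorem ae_cell {j : Fin P.N} {p : E d → Prop} (h : ∀ x ∈ P.Ω, p x) :
    ∀ᵐ x ∂volume.restrict (P.cell j), p x :=
  (ae_restrict_iff' (P.isOpen_cell j).measurableSet).2
    (Eventually.of_forall fun x hx => h x (P.cell_subset_Ω j hx))

theorem mem_L2Field {v : Displ d} (hv : v ∈ P.H1a) : v.1 ∈ L2Field P.Ω := hv.1.1

theorem integrableOn_pairing {u v : Displ d} (hu : u ∈ P.H1a) (hv : v ∈ P.H1a) :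
    IntegrableOn (fun x => pairing (P.mu x) (P.lam x) (u.2 x) (v.2 x)) P.Ω := by
  obtain ⟨c, C, hc, h⟩ := P.lame_bounds
  have hae : ∀ᵐ x ∂volume.restrict P.Ω, c ≤ P.mu x ∧ P.mu x ≤ C ∧ 0 ≤ P.lam x ∧ P.lam x ≤ C :=
    (ae_restrict_iff' P.isOpen_Ω.measurableSet).2 (Eventually.of_forall h)
  have hG := hu.1.2.1
  have hF := hv.1.2.1
  have hsym : ∀ G : E d → Matrix (Fin d) (Fin d) ℝ,
      (∀ i j, MemLp (fun x => G x i j) 2 (volume.restrict P.Ω)) → ∀ i j,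
      MemLp (fun x => (G x i j + G x j i) / 2) 2 (volume.restrict P.Ω) := by
    intro G hG i j
    simp only [div_eq_inv_mul]
    exact ((hG i j).add (hG j i)).const_mul _
  have htr : ∀ G : E d → Matrix (Fin d) (Fin d) ℝ,
      (∀ i j, MemLp (fun x => G x i j) 2 (volume.restrict P.Ω)) →
      MemLp (fun x => (G x).trace) 2 (volume.restrict P.Ω) := by
    intro G hG
    simp only [Matrix.trace, Matrix.diag_apply]
    exact memLp_finsetSum _ fun i _ => hG i i
  have i1 : Integrable (fun x => ∑ i, ∑ j, (u.2 x i j + u.2 x j i) / 2 *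
      ((v.2 x i j + v.2 x j i) / 2)) (volume.restrict P.Ω) :=
    integrable_finsetSum _ fun i _ => integrable_finsetSum _ fun j _ =>
      (hsym _ hG i j).integrable_mul (hsym _ hF i j)
  have i2 : Integrable (fun x => (u.2 x).trace * (v.2 x).trace) (volume.restrict P.Ω) :=
    (htr _ hG).integrable_mul (htr _ hF)
  have j1 := i1.bdd_mul (c := 2 * C) (P.mu_measurable.const_mul 2).aestronglyMeasurable
    (hae.mono fun x hx => by
      rw [Real.norm_eq_abs, abs_of_nonneg (by linarith [hx.1])]
      linarith [hx.2.1])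
  have j2 := i2.bdd_mul (c := C) P.lam_measurable.aestronglyMeasurable
    (hae.mono fun x hx => by
      rw [Real.norm_eq_abs, abs_of_nonneg hx.2.2.1]
      exact hx.2.2.2)
  refine (j1.add j2).congr (Eventually.of_forall fun x => ?_)
  simp only [pairing, Pi.add_apply]
  ring

theorem integrableOn_cell_pairing (j : Fin P.N) {u v : Displ d} (hu : u ∈ P.H1a)
    (hv : v ∈ P.H1a) :
    IntegrableOn (fun x => pairing (P.mu x) (P.lam x) (u.2 x) (v.2 x)) (P.cell j) :=
  (P.integrableOn_pairing hu hv).mono_set (P.cell_subset_Ω j)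

/-- The energy form of a cell on `H¹_a(Ω)`. -/
def aForm (j : Fin P.N) : P.H1a →ₗ[ℝ] P.H1a →ₗ[ℝ] ℝ :=
  have comm : ∀ u v : P.H1a, P.a (P.cell j) u v = P.a (P.cell j) v u := fun u v => by
    simp only [a_eq, pairing_comm]
  have add : ∀ u u' v : P.H1a, P.a (P.cell j) (u + u' : P.H1a) v =
      P.a (P.cell j) u v + P.a (P.cell j) u' v := fun u u' v => by
    simp only [a_eq]
    rw [← integral_add (P.integrableOn_cell_pairing j u.2 v.2)
      (P.integrableOn_cell_pairing j u'.2 v.2)]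
    exact integral_congr_ae (Eventually.of_forall fun x => pairing_add _ _ _ _ _)
  have smul : ∀ (c : ℝ) (u v : P.H1a), P.a (P.cell j) (c • u : P.H1a) v =
      c • P.a (P.cell j) u v := fun c u v => by
    simp only [a_eq]
    rw [smul_eq_mul, ← integral_const_mul]
    exact integral_congr_ae (Eventually.of_forall fun x => pairing_smul _ _ _ _ _)
  LinearMap.mk₂ ℝ (fun u v => P.a (P.cell j) u v) add smul
    (fun u v v' => by rw [comm, add, comm v, comm v'])
    (fun c u v => by rw [comm, smul, comm v])

theorem aForm_apply (j : Fin P.N) (u v : P.H1a) : P.aForm j u v = P.a (P.cell j) u v := rfl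

theorem aForm_comm (j : Fin P.N) (u v : P.H1a) : P.aForm j u v = P.aForm j v u := by
  simp only [aForm_apply, a_eq, pairing_comm]

theorem aForm_self_nonneg (j : Fin P.N) (u : P.H1a) : 0 ≤ P.aForm j u u := by
  rw [aForm_apply, a_eq]
  exact integral_nonneg_of_ae
    (P.ae_cell fun x hx => pairing_self_nonneg (P.mu_nonneg hx) (P.lam_nonneg hx) _)

theorem a_eq_sum {S : Set (E d)} {J : Finset (Fin P.N)} (h1 : ⋃ j ∈ J, P.cell j ⊆ S)
    (h2 : S ⊆ ⋃ j ∈ J, closure (P.cell j)) (u v : P.H1a) :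
    P.a S u v = ∑ j ∈ J, P.aForm j u v := by
  rw [a_eq, P.setIntegral_eq_sum h1 h2 fun j => P.integrableOn_cell_pairing j u.2 v.2]
  simp only [aForm_apply, a_eq]

theorem a_Ω_eq_sum (u v : P.H1a) : P.a P.Ω u v = ∑ j, P.aForm j u v :=
  P.a_eq_sum (P.iUnion_subset_Ω _) P.Ω_subset u v

theorem a_patch_eq_sum (i : Fin P.N) (m : ℕ) (u v : P.H1a) :
    P.a (P.patch i m) u v = ∑ j ∈ layer P.Touch i m, P.aForm j u v :=
  P.a_eq_sum (iUnion₂_subset fun _ hj => P.cell_subset_patch hj)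
    (subset_closure.trans (P.closure_patch i m).le) u v

theorem aNorm_sq (u : P.H1a) : P.aNorm u ^ 2 = ∑ j, P.aForm j u u := by
  rw [aNorm, a_Ω_eq_sum, Real.sq_sqrt (Finset.sum_nonneg fun j _ => P.aForm_self_nonneg j u)]

/-- A displacement that vanishes on a cell has no energy there. -/
theorem aForm_eq_zero {j : Fin P.N} {u : P.H1a}
    (h : ∀ᵐ x ∂volume.restrict (P.cell j), u.1.1 x = 0) (v : P.H1a) : P.aForm j u v = 0 := by
  rw [aForm_apply, a_eq]
  refine integral_eq_zero_of_ae ?_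
  have hg : ∀ᵐ x ∂volume.restrict (P.cell j), ∀ i k, u.1.2 x i k = 0 :=
    ae_all_iff.2 fun i => ae_all_iff.2 fun k =>
      grad_ae_eq_zero (P.isOpen_cell j) (P.cell_subset_Ω j) u.2.1 h i k
  filter_upwards [hg] with x hx
  simp [pairing, hx, Matrix.trace]

theorem kappa_measurable : Measurable P.kappa := by
  unfold kappa
  refine Finset.measurable_sum _ fun n _ => ?_
  exact (P.lam_measurable.add (P.mu_measurable.const_mul 2)).mul
    ((measurable_fderiv ℝ (P.χ n)).norm.pow_const 2)

theorem kappa_nonneg {x : E d} (hx : x ∈ P.Ω) : 0 ≤ P.kappa x :=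
  Finset.sum_nonneg fun _ _ => mul_nonneg
    (add_nonneg (P.lam_nonneg hx) (mul_nonneg zero_le_two (P.mu_nonneg hx))) (sq_nonneg _)

theorem exists_kappa_le : ∃ C, ∀ x ∈ P.Ω, P.kappa x ≤ C := by
  obtain ⟨c, C, hc, h⟩ := P.lame_bounds
  choose L hL using P.χ_lipschitz
  refine ⟨∑ n, (C + 2 * C) * (L n : ℝ) ^ 2, fun x hx => Finset.sum_le_sum fun n _ => ?_⟩
  have h1 : ‖fderiv ℝ (P.χ n) x‖ ≤ L n := norm_fderiv_le_of_lipschitz ℝ (hL n)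
  have := h x hx
  exact mul_le_mul (by linarith) (pow_le_pow_left₀ (norm_nonneg _) h1 2) (sq_nonneg _)
    (by linarith)

theorem integrableOn_cell_s (j : Fin P.N) {u v : E d → E d} (hu : u ∈ L2Field (P.cell j))
    (hv : v ∈ L2Field (P.cell j)) :
    IntegrableOn (fun x => P.kappa x * ∑ i, u x i * v x i) (P.cell j) := by
  obtain ⟨C, hC⟩ := P.exists_kappa_le
  have i1 : Integrable (fun x => ∑ i, u x i * v x i) (volume.restrict (P.cell j)) :=
    integrable_finsetSum _ fun i _ => (hu i).integrable_mul (hv i)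
  refine i1.bdd_mul (c := C) P.kappa_measurable.aestronglyMeasurable (P.ae_cell fun x hx => ?_)
  rw [Real.norm_eq_abs, abs_of_nonneg (P.kappa_nonneg hx)]
  exact hC x hx

/-- The weighted `L²` form of a cell. -/
def sForm (j : Fin P.N) : L2Field (P.cell j) →ₗ[ℝ] L2Field (P.cell j) →ₗ[ℝ] ℝ :=
  have comm : ∀ u v : L2Field (P.cell j), P.s (P.cell j) u v = P.s (P.cell j) v u := fun u v => by
    simp only [s, mul_comm]
  have add : ∀ u u' v : L2Field (P.cell j), P.s (P.cell j) (u + u' : L2Field (P.cell j)) v =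
      P.s (P.cell j) u v + P.s (P.cell j) u' v := fun u u' v => by
    simp only [s]
    rw [← integral_add (P.integrableOn_cell_s j u.2 v.2) (P.integrableOn_cell_s j u'.2 v.2)]
    refine integral_congr_ae (Eventually.of_forall fun x => ?_)
    simp [add_mul, Finset.sum_add_distrib, mul_add]
  have smul : ∀ (c : ℝ) (u v : L2Field (P.cell j)),
      P.s (P.cell j) (c • u : L2Field (P.cell j)) v = c • P.s (P.cell j) u v := fun c u v => by
    simp only [s]
    rw [smul_eq_mul, ← integral_const_mul]
    refine integral_congr_ae (Eventually.of_forall fun x => ?_)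
    simp only [Submodule.coe_smul, Pi.smul_apply, PiLp.smul_apply, smul_eq_mul, mul_assoc,
      ← Finset.mul_sum]
    ring
  LinearMap.mk₂ ℝ (fun u v => P.s (P.cell j) u v) add smul
    (fun u v v' => by rw [comm, add, comm v, comm v'])
    (fun c u v => by rw [comm, smul, comm v])

theorem sForm_apply (j : Fin P.N) (u v : L2Field (P.cell j)) :
    P.sForm j u v = P.s (P.cell j) u v := rfl

theorem s_comm (S : Set (E d)) (u v : E d → E d) : P.s S u v = P.s S v u := by
  simp only [s, mul_comm]

theorem sForm_self_nonneg (j : Fin P.N) (u : L2Field (P.cell j)) : 0 ≤ P.sForm j u u := by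
  rw [sForm_apply, s]
  exact integral_nonneg_of_ae (P.ae_cell fun x hx => mul_nonneg (P.kappa_nonneg hx)
    (Finset.sum_nonneg fun i _ => mul_self_nonneg _))

theorem s_congr_left {S : Set (E d)} {u u' : E d → E d} (v : E d → E d)
    (h : u =ᵐ[volume.restrict S] u') : P.s S u v = P.s S u' v := by
  refine integral_congr_ae (h.mono fun x hx => ?_)
  simp only [hx]

theorem sq_norm_fderiv_sum_le (η : E d → ℝ) (x : E d) :
    ∑ k, fderiv ℝ η x (EuclideanSpace.single k 1) ^ 2 ≤ ‖fderiv ℝ η x‖ ^ 2 := by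
  set g := (InnerProductSpace.toDual ℝ (E d)).symm (fderiv ℝ η x) with hg
  have h : ∀ k, fderiv ℝ η x (EuclideanSpace.single k 1) = g k := by
    intro k
    have := InnerProductSpace.toDual_symm_apply (𝕜 := ℝ) (x := EuclideanSpace.single k (1 : ℝ))
      (y := fderiv ℝ η x)
    rw [← this, EuclideanSpace.inner_single_right]
    simp [hg]
  have hn : ‖fderiv ℝ η x‖ = ‖g‖ := by simp [hg]
  rw [hn, EuclideanSpace.norm_sq_eq]
  simp [h]

/-- The cutoff function that sums the partition of unity over the nodes in `I`. -/
def cutoffFun (I : Finset (Fin P.M)) (x : E d) : ℝ := ∑ n ∈ I, P.χ n x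

theorem cutoffFun_lipschitz (I : Finset (Fin P.M)) : ∃ L, LipschitzWith L (P.cutoffFun I) := by
  choose L hL using P.χ_lipschitz
  classical
  unfold cutoffFun
  induction I using Finset.induction_on with
  | empty => exact ⟨0, by simp⟩
  | insert n I hn ih =>
    obtain ⟨M, hM⟩ := ih
    refine ⟨L n + M, ?_⟩
    simp only [Finset.sum_insert hn]
    exact (hL n).add hM

theorem abs_cutoffFun_le (I : Finset (Fin P.M)) {x : E d} (hx : x ∈ P.Ω) :
    |P.cutoffFun I x| ≤ 1 := by
  rw [cutoffFun, abs_of_nonneg (Finset.sum_nonneg fun n _ => P.χ_nonneg n x hx),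
    ← P.χ_sum x hx]
  exact Finset.sum_le_sum_of_subset_of_nonneg (Finset.subset_univ I)
    fun n _ _ => P.χ_nonneg n x hx

/-- On a cell only the `2 ^ d` functions of its vertices contribute to the gradient of a cutoff
function, which the weight `κ̃` therefore controls. -/
theorem sq_norm_fderiv_cutoffFun_le (I : Finset (Fin P.M)) {j : Fin P.N} {x : E d}
    (hx : x ∈ P.cell j) (hd : ∀ n, DifferentiableAt ℝ (P.χ n) x) :
    (P.lam x + 2 * P.mu x) * ‖fderiv ℝ (P.cutoffFun I) x‖ ^ 2 ≤ 2 ^ d * P.kappa x := by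
  classical
  have hxΩ := P.cell_subset_Ω j hx
  have hz : ∀ n, n ∉ Finset.univ.image (P.vertex j) → fderiv ℝ (P.χ n) x = 0 := by
    intro n hn
    have hn' : n ∉ range (P.vertex j) := by simpa using hn
    have h0 : P.χ n =ᶠ[nhds x] fun _ => 0 :=
      Filter.eventually_of_mem ((P.isOpen_cell j).mem_nhds hx) (P.χ_support j n hn')
    rw [h0.fderiv_eq]
    simp
  have e : fderiv ℝ (P.cutoffFun I) x =
      ∑ n ∈ I ∩ Finset.univ.image (P.vertex j), fderiv ℝ (P.χ n) x := by
    unfold cutoffFun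
    rw [fderiv_fun_sum fun n _ => hd n]
    refine (Finset.sum_subset Finset.inter_subset_left fun n hn hn' => hz n fun h => ?_).symm
    exact hn' (Finset.mem_inter.2 ⟨hn, h⟩)
  set B := I ∩ Finset.univ.image (P.vertex j) with hB
  have hcard : (B.card : ℝ) ≤ 2 ^ d := by
    have h : B.card ≤ 2 ^ d := by
      refine (Finset.card_le_card Finset.inter_subset_right).trans
        (Finset.card_image_le.trans ?_)
      simp
    exact_mod_cast h
  have hS : 0 ≤ ∑ n, ‖fderiv ℝ (P.χ n) x‖ ^ 2 := Finset.sum_nonneg fun n _ => sq_nonneg _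
  have h1 : ‖fderiv ℝ (P.cutoffFun I) x‖ ^ 2 ≤ 2 ^ d * ∑ n, ‖fderiv ℝ (P.χ n) x‖ ^ 2 := by
    calc ‖fderiv ℝ (P.cutoffFun I) x‖ ^ 2 ≤ (∑ n ∈ B, ‖fderiv ℝ (P.χ n) x‖) ^ 2 := by
          rw [e]
          gcongr
          exact norm_sum_le _ _
      _ ≤ B.card * ∑ n ∈ B, ‖fderiv ℝ (P.χ n) x‖ ^ 2 := sq_sum_le_card_mul_sum_sq
      _ ≤ B.card * ∑ n, ‖fderiv ℝ (P.χ n) x‖ ^ 2 := by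
          gcongr
          exact Finset.subset_univ B
      _ ≤ _ := by gcongr
  rw [kappa, ← Finset.mul_sum]
  have h2 : 0 ≤ P.lam x + 2 * P.mu x := by
    linarith [P.lam_nonneg hxΩ, P.mu_nonneg hxΩ]
  nlinarith [mul_le_mul_of_nonneg_left h1 h2]

/-- Multiplication by the cutoff function, on `H¹_a(Ω)`. -/
def cut (I : Finset (Fin P.M)) (w : P.H1a) : P.H1a :=
  ⟨cutoff (P.cutoffFun I) w.1, by
    obtain ⟨L, hL⟩ := P.cutoffFun_lipschitz I
    exact cutoff_mem_H1Zero P.isOpen_Ω.measurableSet hL (fun x hx => P.abs_cutoffFun_le I hx) w.2⟩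

/-- The restriction of a displacement to a cell. -/
def toL2 (j : Fin P.N) : P.H1a →ₗ[ℝ] L2Field (P.cell j) where
  toFun w := ⟨w.1.1, L2Field_mono (P.cell_subset_Ω j) (P.mem_L2Field w.2)⟩
  map_add' _ _ := rfl
  map_smul' _ _ := rfl

theorem coe_toL2 (j : Fin P.N) (w : P.H1a) : (P.toL2 j w : E d → E d) = w.1.1 := rfl

theorem aForm_cut_le (I : Finset (Fin P.M)) (w : P.H1a) (j : Fin P.N) :
    P.aForm j (P.cut I w) (P.cut I w) ≤
      2 * P.aForm j w w + 2 * 2 ^ d * P.sForm j (P.toL2 j w) (P.toL2 j w) := by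
  choose L hL using P.χ_lipschitz
  have hd : ∀ᵐ x ∂volume.restrict (P.cell j), ∀ n, DifferentiableAt ℝ (P.χ n) x :=
    ae_all_iff.2 fun n => ae_restrict_of_ae (hL n).ae_differentiableAt
  have hw : w.1.1 ∈ L2Field (P.cell j) := (P.toL2 j w).2
  simp only [aForm_apply, sForm_apply, coe_toL2, a_eq, s]
  rw [← integral_const_mul, ← integral_const_mul, ← integral_add
    ((P.integrableOn_cell_pairing j w.2 w.2).const_mul 2)
    ((P.integrableOn_cell_s j hw hw).const_mul _)]
  refine integral_mono_ae (P.integrableOn_cell_pairing j (P.cut I w).2 (P.cut I w).2)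
    (((P.integrableOn_cell_pairing j w.2 w.2).const_mul 2).add
      ((P.integrableOn_cell_s j hw hw).const_mul _)) ?_
  filter_upwards [hd, ae_restrict_mem (P.isOpen_cell j).measurableSet] with x hx hxj
  have hxΩ := P.cell_subset_Ω j hxj
  have hm := P.mu_nonneg hxΩ
  have hl := P.lam_nonneg hxΩ
  set η := P.cutoffFun I
  have e : (P.cut I w).1.2 x = η x • w.1.2 x +
      Matrix.vecMulVec (fun i => w.1.1 x i) fun k => fderiv ℝ η x (EuclideanSpace.single k 1) := by
    ext i k
    simp [cut, cutoff, Matrix.vecMulVec_apply, η]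
  have b1 : pairing (P.mu x) (P.lam x) (η x • w.1.2 x) (η x • w.1.2 x) ≤
      pairing (P.mu x) (P.lam x) (w.1.2 x) (w.1.2 x) := by
    rw [pairing_smul, pairing_comm, pairing_smul, ← mul_assoc, ← sq]
    have h1 : η x ^ 2 ≤ 1 := by
      rw [sq_le_one_iff_abs_le_one]
      exact P.abs_cutoffFun_le I hxΩ
    exact mul_le_of_le_one_left (pairing_self_nonneg hm hl _) h1
  have b2 := pairing_vecMulVec_le hm hl (fun i => w.1.1 x i)
    fun k => fderiv ℝ η x (EuclideanSpace.single k 1)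
  have b3 := sq_norm_fderiv_sum_le η x
  have b4 := P.sq_norm_fderiv_cutoffFun_le I hxj hx
  have hW : 0 ≤ ∑ i, w.1.1 x i ^ 2 := Finset.sum_nonneg fun i _ => sq_nonneg _
  have b5 : (P.lam x + 2 * P.mu x) * ((∑ i, w.1.1 x i ^ 2) *
      ∑ k, fderiv ℝ η x (EuclideanSpace.single k 1) ^ 2) ≤
      2 ^ d * (P.kappa x * ∑ i, w.1.1 x i * w.1.1 x i) := by
    simp only [← sq]
    calc _ ≤ (P.lam x + 2 * P.mu x) * ((∑ i, w.1.1 x i ^ 2) * ‖fderiv ℝ η x‖ ^ 2) := by gcongr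
      _ = (P.lam x + 2 * P.mu x) * ‖fderiv ℝ η x‖ ^ 2 * ∑ i, w.1.1 x i ^ 2 := by ring
      _ ≤ 2 ^ d * P.kappa x * ∑ i, w.1.1 x i ^ 2 := by gcongr
      _ = _ := by ring
  have b6 := pairing_add_self_le hm hl (η x • w.1.2 x)
    (Matrix.vecMulVec (fun i => w.1.1 x i) fun k => fderiv ℝ η x (EuclideanSpace.single k 1))
  rw [e]
  linarith

end Problem

/-! ### Positive semidefinite forms -/

section Form

variable {X : Type*} [AddCommGroup X] [Module ℝ X] {B : X →ₗ[ℝ] X →ₗ[ℝ] ℝ}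

theorem form_abs_le (hs : ∀ x y, B x y = B y x) (h0 : ∀ x, 0 ≤ B x x) (x y : X) :
    |B x y| ≤ √(B x x) * √(B y y) := by
  rw [← Real.sqrt_mul (h0 x)]
  refine Real.abs_le_sqrt ?_
  have := LinearMap.BilinForm.apply_mul_apply_le_of_forall_zero_le B h0 x y
  rwa [hs y x, ← sq] at this

theorem form_sum_le (hs : ∀ x y, B x y = B y x) (h0 : ∀ x, 0 ≤ B x x) {ι : Type*} (t : Finset ι)
    (x : ι → X) : B (∑ i ∈ t, x i) (∑ i ∈ t, x i) ≤ (∑ i ∈ t, √(B (x i) (x i))) ^ 2 := by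
  rw [sq, Finset.sum_mul_sum, map_sum B, LinearMap.sum_apply]
  refine Finset.sum_le_sum fun i _ => ?_
  rw [map_sum (B (x i))]
  exact Finset.sum_le_sum fun j _ => (le_abs_self _).trans (form_abs_le hs h0 _ _)

theorem form_sub_le (h0 : ∀ x, 0 ≤ B x x) (x y : X) :
    B (x - y) (x - y) ≤ 2 * B x x + 2 * B y y := by
  have h := h0 (x + y)
  simp only [map_add, map_sub, LinearMap.add_apply, LinearMap.sub_apply] at h ⊢
  linarith

end Form

/-! ### Local projections and the constrained space -/

namespace AuxProblem

variable (P : AuxProblem d)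

/-- The selected eigenfunctions, as square integrable fields on their cell. -/
def eig (j : Fin P.N) (i : Fin (P.g j)) : L2Field (P.cell j) :=
  ⟨(P.φ j i).1, (P.V_le_H1 j (P.eigen j i).1).1⟩

theorem sForm_eig_pos (j : Fin P.N) (i : Fin (P.g j)) : 0 < P.sForm j (P.eig j i) (P.eig j i) :=
  (P.eigen j i).2.1

theorem sForm_eig_ne {j : Fin P.N} {i k : Fin (P.g j)} (h : i ≠ k) :
    P.sForm j (P.eig j i) (P.eig j k) = 0 := P.φ_orth j h

theorem sForm_comm (j : Fin P.N) (u v : L2Field (P.cell j)) :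
    P.sForm j u v = P.sForm j v u := P.s_comm _ _ _

theorem sForm_sum_eig (j : Fin P.N) (c : Fin (P.g j) → ℝ) (k : Fin (P.g j)) :
    P.sForm j (∑ i, c i • P.eig j i) (P.eig j k) = c k * P.sForm j (P.eig j k) (P.eig j k) := by
  rw [map_sum, LinearMap.sum_apply, Finset.sum_eq_single k]
  · simp
  · intro i _ hik
    simp [P.sForm_eig_ne hik]
  · simp

/-- The local projection on square integrable fields. -/
def projL2 (j : Fin P.N) (v : L2Field (P.cell j)) : L2Field (P.cell j) :=
  ∑ i, (P.sForm j v (P.eig j i) / P.sForm j (P.eig j i) (P.eig j i)) • P.eig j i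

theorem coe_projL2 (j : Fin P.N) (v : L2Field (P.cell j)) :
    (P.projL2 j v : E d → E d) = P.projLoc j v := by
  simp only [projL2, projLoc, AddSubmonoidClass.coe_finsetSum, Submodule.coe_smul]
  rfl

theorem sForm_projL2_eig (j : Fin P.N) (v : L2Field (P.cell j)) (k : Fin (P.g j)) :
    P.sForm j (P.projL2 j v) (P.eig j k) = P.sForm j v (P.eig j k) := by
  rw [projL2, P.sForm_sum_eig j, div_mul_cancel₀ _ (P.sForm_eig_pos j k).ne']

/-- Bessel's inequality. -/
theorem sForm_projL2_le (j : Fin P.N) (v : L2Field (P.cell j)) :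
    P.sForm j (P.projL2 j v) (P.projL2 j v) ≤ P.sForm j v v := by
  set q := P.projL2 j v with hq
  have h : P.sForm j q q = P.sForm j v q := by
    have e : ∀ u, P.sForm j u q =
        ∑ i, P.sForm j v (P.eig j i) / P.sForm j (P.eig j i) (P.eig j i) *
          P.sForm j u (P.eig j i) := fun u => by
      rw [hq, projL2, map_sum]
      simp only [map_smul, smul_eq_mul]
    rw [e, e, hq]
    simp only [P.sForm_projL2_eig]
  have h0 := P.sForm_self_nonneg j (v - q)
  simp only [map_sub, LinearMap.sub_apply] at h0
  linarith [P.sForm_comm j v q]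

theorem proj_eq_projLoc {j : Fin P.N} (v : E d → E d) {x : E d} (hx : x ∈ P.cell j) :
    P.proj v x = P.projLoc j v x := by
  rw [proj, Finset.sum_apply, Finset.sum_eq_single j]
  · exact indicator_of_mem hx _
  · intro k _ hk
    exact indicator_of_notMem (fun hxk => (P.cell_disjoint hk).le_bot ⟨hxk, hx⟩) _
  · simp

theorem sForm_congr {j : Fin P.N} {u u' : L2Field (P.cell j)} (v : L2Field (P.cell j))
    (h : (u : E d → E d) =ᵐ[volume.restrict (P.cell j)] u') : P.sForm j u v = P.sForm j u' v :=
  P.s_congr_left _ h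

/-- `W_h` as a subspace: the fields that are `s`-orthogonal to all selected eigenfunctions. -/
def constrained : Submodule ℝ P.H1a where
  carrier := {w | ∀ j i, P.sForm j (P.toL2 j w) (P.eig j i) = 0}
  zero_mem' := fun j i => by simp
  add_mem' := fun hu hv j i => by
    rw [map_add, map_add, LinearMap.add_apply, hu j i, hv j i, add_zero]
  smul_mem' := fun c u hu j i => by
    rw [map_smul, map_smul, LinearMap.smul_apply, hu j i, smul_zero]

theorem proj_eq_zero {w : P.H1a} (h : w ∈ P.constrained) : P.proj w.1.1 = 0 := by
  refine Finset.sum_eq_zero fun j _ => ?_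
  have h0 : P.projL2 j (P.toL2 j w) = 0 :=
    Finset.sum_eq_zero fun i _ => by rw [h j i, zero_div, zero_smul]
  have h1 := P.coe_projL2 j (P.toL2 j w)
  rw [h0, Problem.coe_toL2] at h1
  rw [← h1]
  exact indicator_zero _ _

theorem mem_Wh_iff {w : P.H1a} : w ∈ P.Wh ↔ w ∈ P.constrained := by
  constructor
  · intro h j i
    have h' : (P.projL2 j (P.toL2 j w) : E d → E d) =ᵐ[volume.restrict (P.cell j)]
        (0 : L2Field (P.cell j)) := by
      filter_upwards [P.ae_restrict_Ω_iff.1 h j,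
        ae_restrict_mem (P.isOpen_cell j).measurableSet] with x hx hxj
      rw [P.proj_eq_projLoc _ hxj] at hx
      rw [P.coe_projL2, Problem.coe_toL2, hx]
      rfl
    rw [← P.sForm_projL2_eig, P.sForm_congr _ h']
    simp
  · intro h
    change P.proj w.1.1 =ᵐ[volume.restrict P.Ω] 0
    rw [P.proj_eq_zero h]

/-- The displacements in `H¹_a(Ω)` that vanish on a cell. -/
def vanishing (j : Fin P.N) : Submodule ℝ P.H1a where
  carrier := {w | ∀ᵐ x ∂volume.restrict (P.cell j), w.1.1 x = 0}
  zero_mem' := by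
    change ∀ᵐ x ∂volume.restrict (P.cell j), (0 : E d) = 0
    exact Eventually.of_forall fun x => rfl
  add_mem' := fun {u v} hu hv => by
    change ∀ᵐ x ∂volume.restrict (P.cell j), u.1.1 x + v.1.1 x = 0
    filter_upwards [hu, hv] with x h1 h2
    rw [h1, h2, add_zero]
  smul_mem' := fun c u hu => by
    change ∀ᵐ x ∂volume.restrict (P.cell j), c • u.1.1 x = 0
    filter_upwards [hu] with x h1
    rw [h1, smul_zero]

theorem sForm_eq_zero_of_vanishing {j : Fin P.N} {w : P.H1a} (h : w ∈ P.vanishing j)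
    (v : L2Field (P.cell j)) : P.sForm j (P.toL2 j w) v = 0 := by
  have h' : (P.toL2 j w : E d → E d) =ᵐ[volume.restrict (P.cell j)] (0 : L2Field (P.cell j)) := h
  rw [P.sForm_congr v h']
  simp

theorem aForm_eq_zero_of_vanishing {j : Fin P.N} {w : P.H1a} (h : w ∈ P.vanishing j)
    (v : P.H1a) : P.aForm j w v = 0 := P.aForm_eq_zero h v

/-- Vanishing almost everywhere in `Ω \ S`, cell by cell. -/
theorem ae_diff_iff {S : Set (E d)} {J : Finset (Fin P.N)} (hS : MeasurableSet S)
    (h1 : ∀ j ∈ J, P.cell j ⊆ S) (h2 : ∀ j ∉ J, Disjoint (P.cell j) S) {w : P.H1a} :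
    (∀ᵐ x ∂volume.restrict (P.Ω \ S), w.1.1 x = 0) ↔ ∀ j ∉ J, w ∈ P.vanishing j := by
  have hm : MeasurableSet (P.Ω \ S) := P.isOpen_Ω.measurableSet.diff hS
  constructor
  · intro h j hj
    exact ae_restrict_of_ae_restrict_of_subset
      (subset_sdiff.2 ⟨P.cell_subset_Ω j, h2 j hj⟩) h
  · intro h
    rw [ae_restrict_iff' hm]
    have h' : ∀ᵐ x ∂volume.restrict P.Ω, x ∉ S → w.1.1 x = 0 := by
      rw [P.ae_restrict_Ω_iff]
      intro j
      by_cases hj : j ∈ J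
      · filter_upwards [ae_restrict_mem (P.isOpen_cell j).measurableSet] with x hx hxS
        exact absurd (h1 j hj hx) hxS
      · have hv : ∀ᵐ x ∂volume.restrict (P.cell j), w.1.1 x = 0 := h j hj
        filter_upwards [hv] with x hx _ using hx
    rw [ae_restrict_iff' P.isOpen_Ω.measurableSet] at h'
    filter_upwards [h'] with x hx hxm using hx hxm.1 hxm.2

theorem ae_diff_cell_iff {j : Fin P.N} {w : P.H1a} :
    (∀ᵐ x ∂volume.restrict (P.Ω \ P.cell j), w.1.1 x = 0) ↔ ∀ k, k ≠ j → w ∈ P.vanishing k := by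
  rw [P.ae_diff_iff (J := {j}) (P.isOpen_cell j).measurableSet]
  · simp
  · intro k hk
    rw [Finset.mem_singleton.1 hk]
  · intro k hk
    exact P.cell_disjoint (by simpa using hk)

/-- On the constrained space the weighted `L²` norm is controlled, cell by cell, by the energy. -/
theorem mul_sForm_le_aForm {Λ : ℝ} {j : Fin P.N} (h : Λ ≤ P.nextEigenvalue j)
    {w : P.H1a} (hw : w ∈ P.constrained) :
    Λ * P.sForm j (P.toL2 j w) (P.toL2 j w) ≤ P.aForm j w w := by
  set t := P.sForm j (P.toL2 j w) (P.toL2 j w) with ht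
  rcases (P.sForm_self_nonneg j (P.toL2 j w)).eq_or_lt with h0 | h0
  · rw [ht, ← h0, mul_zero]
    exact P.aForm_self_nonneg j w
  rw [← ht] at h0
  have hb : BddBelow {t | ∃ v ∈ P.V j, (∀ i, P.s (P.cell j) v.1 (P.φ j i).1 = 0) ∧
      P.s (P.cell j) v.1 v.1 = 1 ∧ t = P.a (P.cell j) v v} := by
    refine ⟨0, ?_⟩
    rintro _ ⟨v, -, -, -, rfl⟩
    rw [P.a_eq]
    exact integral_nonneg_of_ae
      (P.ae_cell fun x hx => pairing_self_nonneg (P.mu_nonneg hx) (P.lam_nonneg hx) _)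
  set c : ℝ := (√t)⁻¹ with hc
  have hcc : c * c = t⁻¹ := by rw [hc, ← mul_inv, Real.mul_self_sqrt h0.le]
  have hmem := csInf_le hb (a := P.aForm j (c • w) (c • w)) ⟨(c • w : P.H1a).1,
    P.H1a_le_V j (c • w).2, fun i => (P.constrained.smul_mem c hw) j i, ?_, rfl⟩
  · have := h.trans hmem
    simp only [map_smul, LinearMap.smul_apply, smul_eq_mul] at this
    rw [← mul_assoc, hcc, inv_mul_eq_div, le_div_iff₀ h0] at this
    exact this
  · change P.sForm j (P.toL2 j (c • w)) (P.toL2 j (c • w)) = 1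
    simp only [map_smul, LinearMap.smul_apply, smul_eq_mul]
    rw [← mul_assoc, hcc, ← ht, inv_mul_cancel₀ h0.ne']

end AuxProblem

/-! ### Lifts and the cutoff in the constrained space -/

/-- The constant in the stability of the cutoff. -/
def cutConst (d : ℕ) (Λ A : ℝ) : ℝ := 2 * (2 + 2 * 2 ^ d * Λ⁻¹) + 2 * ((A + 1) ^ 2 * Λ⁻¹)

theorem cutConst_pos (d : ℕ) {Λ : ℝ} (hΛ : 0 < Λ) (A : ℝ) : 0 < cutConst d Λ A := by
  rw [cutConst]
  positivity

namespace AuxProblem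

variable (P : AuxProblem d)

/-- A smooth scalar function with compact support in a cell, times a coordinate vector, is a
displacement in `H¹_a(Ω)` that vanishes on the other cells. -/
theorem exists_test {j : Fin P.N} {ζ : E d → ℝ} (h1 : ContDiff ℝ ∞ ζ) (h2 : HasCompactSupport ζ)
    (h3 : tsupport ζ ⊆ P.cell j) (i : Fin d) :
    ∃ z : P.H1a, z.1.1 = (fun x => EuclideanSpace.single i (ζ x)) ∧
      ∀ k, k ≠ j → z ∈ P.vanishing k := by
  have hz : ∀ x, x ∉ tsupport ζ → ζ x = 0 := fun x hx => image_eq_zero_of_notMem_tsupport hx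
  have hadm : IsAdmissible P.Γa fun x => EuclideanSpace.single i (ζ x) := by
    obtain ⟨C, hC⟩ := ContDiff.lipschitzWith_of_hasCompactSupport (𝕂 := ℝ) h2 h1 (by simp)
    refine ⟨⟨C, LipschitzWith.of_dist_le_mul fun x y => ?_⟩,
      h2.comp_left (g := fun t : ℝ => (EuclideanSpace.single i t : E d)) (by simp),
      (tsupport ζ)ᶜ, (isClosed_tsupport ζ).isOpen_compl, fun x hx hxs => ?_, fun x hx => ?_⟩
    · rw [PiLp.dist_single_same]
      exact hC.dist_le_mul x y
    · have := P.Γa_subset hx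
      rw [P.isOpen_Ω.frontier_eq] at this
      exact this.2 (P.cell_subset_Ω j (h3 hxs))
    · simp [hz x hx]
  refine ⟨⟨_, hadm.ofField_mem⟩, rfl, fun k hk => ?_⟩
  have h : ∀ᵐ x ∂volume.restrict (P.cell k), (EuclideanSpace.single i (ζ x) : E d) = 0 := by
    filter_upwards [ae_restrict_mem (P.isOpen_cell k).measurableSet] with x hx
    rw [hz x fun hxs => (P.cell_disjoint hk).le_bot ⟨hx, h3 hxs⟩]
    simp
  exact h

/-- A square integrable field that is `s`-orthogonal to the displacements supported in the cell is
`s`-orthogonal to everything. -/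
theorem sForm_eq_zero_of_orthogonal {j : Fin P.N} {q : L2Field (P.cell j)}
    (h : ∀ z : P.H1a, (∀ k, k ≠ j → z ∈ P.vanishing k) → P.sForm j (P.toL2 j z) q = 0)
    (v : L2Field (P.cell j)) : P.sForm j q v = 0 := by
  obtain ⟨C, hC⟩ := P.exists_kappa_le
  have hq : ∀ i, ∀ᵐ x ∂volume, x ∈ P.cell j → P.kappa x * (q : E d → E d) x i = 0 := by
    intro i
    have hm : MemLp (fun x => P.kappa x * (q : E d → E d) x i) 2 (volume.restrict (P.cell j)) := by
      refine memLp_mul_of_bound (c := C) P.kappa_measurable.aestronglyMeasurable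
        (P.ae_cell fun x hx => ?_) (q.2 i)
      rw [abs_of_nonneg (P.kappa_nonneg hx)]
      exact hC x hx
    refine (P.isOpen_cell j).ae_eq_zero_of_integral_contDiff_smul_eq_zero
      (locallyIntegrableOn_of_locallyIntegrable_restrict (hm.locallyIntegrable (by norm_num)))
      fun ζ h1 h2 h3 => ?_
    obtain ⟨z, hz, hv⟩ := P.exists_test h1 h2 h3 i
    have key := h z hv
    rw [Problem.sForm_apply, Problem.coe_toL2, hz, Problem.s] at key
    rw [← setIntegral_eq_integral_of_forall_compl_eq_zero (s := P.cell j) (fun x hx => ?_), ← key]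
    · refine integral_congr_ae (Eventually.of_forall fun x => ?_)
      simp only [smul_eq_mul]
      rw [Finset.sum_eq_single i]
      · simp
        ring
      · intro k _ hk
        simp [hk]
      · simp
    · rw [image_eq_zero_of_notMem_tsupport fun hxs => hx (h3 hxs), zero_smul]
  rw [Problem.sForm_apply, Problem.s]
  refine integral_eq_zero_of_ae ?_
  rw [EventuallyEq, ae_restrict_iff' (P.isOpen_cell j).measurableSet]
  filter_upwards [ae_all_iff.2 hq] with x hx hxj
  simp only [Finset.mul_sum, ← mul_assoc, hx _ hxj, zero_mul, Finset.sum_const_zero]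
  rfl

/-- The local moments `s(z, φ)` of the displacements supported in one cell take all values: a
functional that annihilates them gives an auxiliary field that is `s`-orthogonal to all such
displacements, hence to itself. -/
theorem exists_moments (j : Fin P.N) (y : Fin (P.g j) → ℝ) :
    ∃ z : P.H1a, (∀ k, k ≠ j → z ∈ P.vanishing k) ∧
      ∀ i, P.sForm j (P.toL2 j z) (P.eig j i) = y i := by
  let Z : Submodule ℝ P.H1a := ⨅ k, ⨅ _ : k ≠ j, P.vanishing k
  have hZ : ∀ z, z ∈ Z ↔ ∀ k, k ≠ j → z ∈ P.vanishing k := fun z => by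
    simp [Z, Submodule.mem_iInf]
  let R : Z →ₗ[ℝ] (Fin (P.g j) → ℝ) :=
    LinearMap.pi fun i => ((P.sForm j).flip (P.eig j i)) ∘ₗ P.toL2 j ∘ₗ Z.subtype
  have hR : ∀ z i, R z i = P.sForm j (P.toL2 j z) (P.eig j i) := fun z i => rfl
  have htop : LinearMap.range R = ⊤ := by
    by_contra hne
    obtain ⟨f, hf0, hf⟩ := Submodule.exists_le_ker_of_lt_top _ (lt_top_iff_ne_top.2 hne)
    apply hf0
    set c : Fin (P.g j) → ℝ := fun i => f (Pi.single i 1) with hc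
    have hfc : ∀ y, f y = ∑ i, c i * y i := by
      intro y
      conv_lhs => rw [pi_eq_sum_univ' y]
      simp only [map_sum, map_smul, smul_eq_mul, hc, mul_comm]
    have hq := P.sForm_eq_zero_of_orthogonal (j := j) (q := ∑ i, c i • P.eig j i) (by
      intro z hz
      have := hf ⟨⟨z, (hZ z).2 hz⟩, rfl⟩
      rw [LinearMap.mem_ker, hfc] at this
      simpa [hR] using this)
    have hc0 : ∀ k, c k = 0 := by
      intro k
      have := hq (P.eig j k)
      rw [P.sForm_sum_eig] at this
      exact (mul_eq_zero.1 this).resolve_right (P.sForm_eig_pos j k).ne'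
    refine LinearMap.ext fun y => ?_
    simp [hfc, hc0]
  obtain ⟨z, hz⟩ : y ∈ LinearMap.range R := htop ▸ Submodule.mem_top
  exact ⟨z, (hZ _).1 z.2, fun i => by rw [← hR, hz]⟩

theorem proj_eq_indicator {j : Fin P.N} {z : P.H1a} (hz : ∀ k, k ≠ j → z ∈ P.vanishing k)
    {c : Fin (P.g j) → ℝ}
    (hc : ∀ i, P.sForm j (P.toL2 j z) (P.eig j i) = c i * P.sForm j (P.eig j i) (P.eig j i)) :
    P.proj z.1.1 = (P.cell j).indicator (∑ i, c i • (P.φ j i).1) := by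
  rw [proj, Finset.sum_eq_single j]
  · congr 1
    refine Finset.sum_congr rfl fun i _ => ?_
    congr 1
    exact (div_eq_iff (P.sForm_eig_pos j i).ne').2 (hc i)
  · intro k _ hk
    have h0 : P.projL2 k (P.toL2 k z) = 0 :=
      Finset.sum_eq_zero fun i _ => by
        rw [P.sForm_eq_zero_of_vanishing (hz k hk), zero_div, zero_smul]
    have h1 := P.coe_projL2 k (P.toL2 k z)
    rw [h0, Problem.coe_toL2] at h1
    rw [← h1]
    exact indicator_zero _ _
  · simp

/-- The auxiliary fields of a cell have lifts supported in the cell, with a bound on the energy. -/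
theorem exists_bounded_lift (j : Fin P.N) :
    ∃ A, 0 ≤ A ∧ ∀ c : Fin (P.g j) → ℝ, ∃ w : P.H1a, (∀ k, k ≠ j → w ∈ P.vanishing k) ∧
      (∀ k, P.sForm j (P.toL2 j w) (P.eig j k) = c k * P.sForm j (P.eig j k) (P.eig j k)) ∧
      P.aForm j w w ≤
        (A * √(P.sForm j (∑ i, c i • P.eig j i) (∑ i, c i • P.eig j i))) ^ 2 := by
  choose z hzv hz using P.exists_moments j
  -- `b i` lifts the `i`-th eigenfunction
  set σ : Fin (P.g j) → ℝ := fun i => P.sForm j (P.eig j i) (P.eig j i) with hσ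
  have hσpos : ∀ i, 0 < σ i := fun i => P.sForm_eig_pos j i
  set b : Fin (P.g j) → P.H1a := fun i => z (Pi.single i (σ i)) with hb
  refine ⟨∑ i, √(P.aForm j (b i) (b i)) / √(σ i),
    Finset.sum_nonneg fun i _ => by positivity, fun c => ?_⟩
  refine ⟨∑ i, c i • b i, fun k hk =>
    Submodule.sum_mem _ fun i _ => Submodule.smul_mem _ _ (hzv _ k hk), fun k => ?_, ?_⟩
  · rw [map_sum, map_sum, LinearMap.sum_apply, Finset.sum_eq_single k]
    · simp [hb, hz, hσ]
    · intro i _ hik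
      simp [hb, hz, hik.symm]
    · simp
  set Q : L2Field (P.cell j) := ∑ i, c i • P.eig j i with hQ
  have hQk : ∀ k, |c k| * √(σ k) ≤ √(P.sForm j Q Q) := by
    intro k
    have h1 := form_abs_le (P.sForm_comm j) (P.sForm_self_nonneg j) Q (P.eig j k)
    rw [hQ, P.sForm_sum_eig, ← hQ, abs_mul, abs_of_pos (P.sForm_eig_pos j k)] at h1
    refine le_of_mul_le_mul_right ?_ (Real.sqrt_pos.2 (hσpos k))
    rw [mul_assoc, Real.mul_self_sqrt (hσpos k).le]
    exact h1
  refine (form_sum_le (P.aForm_comm j) (P.aForm_self_nonneg j) _ _).trans ?_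
  refine pow_le_pow_left₀ (Finset.sum_nonneg fun i _ => Real.sqrt_nonneg _) ?_ 2
  rw [Finset.sum_mul]
  refine Finset.sum_le_sum fun i _ => ?_
  have e : √(P.aForm j (c i • b i) (c i • b i)) = |c i| * √(P.aForm j (b i) (b i)) := by
    simp only [map_smul, LinearMap.smul_apply, smul_eq_mul]
    rw [← mul_assoc, Real.sqrt_mul (mul_self_nonneg _), Real.sqrt_mul_self_eq_abs]
  rw [e, div_mul_eq_mul_div, le_div_iff₀ (Real.sqrt_pos.2 (hσpos i))]
  have := mul_le_mul_of_nonneg_left (hQk i) (Real.sqrt_nonneg (P.aForm j (b i) (b i)))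
  linarith

theorem aNorm_sq_of_vanishing {j : Fin P.N} {w : P.H1a} (h : ∀ k, k ≠ j → w ∈ P.vanishing k) :
    P.aNorm w ^ 2 = P.aForm j w w := by
  rw [P.aNorm_sq, Finset.sum_eq_single j]
  · intro k _ hk
    exact P.aForm_eq_zero_of_vanishing (h k hk) w
  · simp

/-- Some constant is admissible in the definition of `liftConst`, so that this infimum is not taken
over the empty set. -/
theorem liftConst_nonempty : {A | 0 ≤ A ∧ ∀ j, ∀ q ∈ P.Vaux j, ∃ z ∈ P.H1a,
    (∀ᵐ x ∂volume.restrict (P.Ω \ P.cell j), z.1 x = 0) ∧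
    P.proj z.1 =ᵐ[volume.restrict P.Ω] (P.cell j).indicator q ∧
    P.aNorm z ≤ A * √(P.s (P.cell j) q q)}.Nonempty := by
  choose A hA hlift using P.exists_bounded_lift
  refine ⟨∑ j, A j, Finset.sum_nonneg fun j _ => hA j, fun j q hq => ?_⟩
  obtain ⟨c, rfl⟩ := (Submodule.mem_span_range_iff_exists_fun ℝ).1 hq
  obtain ⟨w, hwv, hmom, hle⟩ := hlift j c
  set Q : L2Field (P.cell j) := ∑ i, c i • P.eig j i with hQ
  have hQc : (∑ i, c i • (P.φ j i).1 : E d → E d) = Q := by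
    rw [hQ]
    simp only [AddSubmonoidClass.coe_finsetSum, Submodule.coe_smul]
    rfl
  refine ⟨w, w.2, P.ae_diff_cell_iff.2 hwv, ?_, ?_⟩
  · rw [P.proj_eq_indicator hwv hmom]
  rw [hQc, ← Problem.sForm_apply]
  rw [← P.aNorm_sq_of_vanishing hwv] at hle
  refine (abs_le_of_sq_le_sq' hle (mul_nonneg (hA j) (Real.sqrt_nonneg _))).2.trans ?_
  exact mul_le_mul_of_nonneg_right
    (Finset.single_le_sum (fun j _ => hA j) (Finset.mem_univ j)) (Real.sqrt_nonneg _)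

/-- Every square integrable field has the local moments of a displacement supported in the cell,
with a bound on the energy. The lift is zero if the moments vanish. -/
theorem exists_lift {A : ℝ} (hA : 0 ≤ A) (h : P.liftConst ≤ A) (j : Fin P.N)
    (f : L2Field (P.cell j)) :
    ∃ z : P.H1a, (∀ k, k ≠ j → z ∈ P.vanishing k) ∧
      (∀ i, P.sForm j (P.toL2 j z) (P.eig j i) = P.sForm j f (P.eig j i)) ∧
      P.aForm j z z ≤ (A + 1) ^ 2 * P.sForm j f f ∧
      ((∀ i, P.sForm j f (P.eig j i) = 0) → z = 0) := by
  by_cases h0 : ∀ i, P.sForm j f (P.eig j i) = 0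
  · refine ⟨0, fun k _ => Submodule.zero_mem _, fun i => by simp [h0 i], ?_, fun _ => rfl⟩
    simp only [map_zero]
    exact mul_nonneg (sq_nonneg _) (P.sForm_self_nonneg j f)
  obtain ⟨B, ⟨hB0, hB⟩, hBA⟩ := exists_lt_of_csInf_lt P.liftConst_nonempty
    (h.trans_lt (lt_add_one A))
  have hmem : P.projLoc j f ∈ P.Vaux j :=
    Submodule.sum_mem _ fun i _ => Submodule.smul_mem _ _ (Submodule.subset_span ⟨i, rfl⟩)
  obtain ⟨z, hz, hzv, hzp, hza⟩ := hB j _ hmem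
  refine ⟨⟨z, hz⟩, P.ae_diff_cell_iff.1 hzv, fun i => ?_, ?_, fun h' => absurd h' h0⟩
  · have e : (P.projL2 j (P.toL2 j ⟨z, hz⟩) : E d → E d) =ᵐ[volume.restrict (P.cell j)]
        P.projL2 j f := by
      filter_upwards [P.ae_restrict_Ω_iff.1 hzp j,
        ae_restrict_mem (P.isOpen_cell j).measurableSet] with x hx hxj
      rw [P.proj_eq_projLoc _ hxj, indicator_of_mem hxj] at hx
      rw [P.coe_projL2, P.coe_projL2, Problem.coe_toL2]
      exact hx
    rw [← P.sForm_projL2_eig, P.sForm_congr _ e, P.sForm_projL2_eig]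
  · have e : P.s (P.cell j) (P.projLoc j f) (P.projLoc j f) =
        P.sForm j (P.projL2 j f) (P.projL2 j f) := by
      rw [Problem.sForm_apply, P.coe_projL2]
    rw [e] at hza
    have hs := P.sForm_self_nonneg j (P.projL2 j f)
    calc P.aForm j ⟨z, hz⟩ ⟨z, hz⟩ ≤ ∑ k, P.aForm k ⟨z, hz⟩ ⟨z, hz⟩ :=
          Finset.single_le_sum (f := fun k => P.aForm k ⟨z, hz⟩ ⟨z, hz⟩)
            (fun k _ => P.aForm_self_nonneg k _) (Finset.mem_univ j)
      _ = P.aNorm z ^ 2 := (P.aNorm_sq ⟨z, hz⟩).symm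
      _ ≤ (B * √(P.sForm j (P.projL2 j f) (P.projL2 j f))) ^ 2 :=
          pow_le_pow_left₀ (Real.sqrt_nonneg _) hza 2
      _ = B ^ 2 * P.sForm j (P.projL2 j f) (P.projL2 j f) := by rw [mul_pow, Real.sq_sqrt hs]
      _ ≤ (A + 1) ^ 2 * P.sForm j f f := by
          gcongr
          exact P.sForm_projL2_le j f

theorem sForm_cut_le (I : Finset (Fin P.M)) (w : P.H1a) (j : Fin P.N) :
    P.sForm j (P.toL2 j (P.cut I w)) (P.toL2 j (P.cut I w)) ≤
      P.sForm j (P.toL2 j w) (P.toL2 j w) := by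
  refine integral_mono_ae (P.integrableOn_cell_s j (P.toL2 j (P.cut I w)).2
    (P.toL2 j (P.cut I w)).2) (P.integrableOn_cell_s j (P.toL2 j w).2 (P.toL2 j w).2)
    (P.ae_cell fun x hx => ?_)
  refine mul_le_mul_of_nonneg_left (Finset.sum_le_sum fun i _ => ?_) (P.kappa_nonneg hx)
  have h1 : P.cutoffFun I x ^ 2 ≤ 1 := by
    rw [sq_le_one_iff_abs_le_one]
    exact P.abs_cutoffFun_le I hx
  have e : (P.toL2 j (P.cut I w) : E d → E d) x i = P.cutoffFun I x * w.1.1 x i := rfl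
  rw [e, Problem.coe_toL2]
  nlinarith [mul_le_mul_of_nonneg_right h1 (sq_nonneg (w.1.1 x i))]

/-- Cutting off within the constrained space: a field in `W_h` is set to zero on the cells in `J`
and kept on the cells that do not touch `J`. In between it is multiplied by a cutoff function, and
the constraint is restored by local lifts, which do not leave their cells. -/
theorem exists_cutoff {Λ A : ℝ} (hΛ : 0 < Λ) (hA : 0 ≤ A) (hev : ∀ j, Λ ≤ P.nextEigenvalue j)
    (hlift : P.liftConst ≤ A) (J : Finset (Fin P.N)) {w : P.H1a} (hw : w ∈ P.constrained) :
    ∃ v ∈ P.constrained, (∀ j ∈ J, v ∈ P.vanishing j) ∧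
      (∀ j, (∀ k ∈ J, ¬ P.Touch j k) → v - w ∈ P.vanishing j) ∧
      ∀ j, P.aForm j v v ≤ cutConst d Λ A * P.aForm j w w := by
  classical
  set I : Finset (Fin P.M) := Finset.univ.filter fun n => ∀ j ∈ J, n ∉ range (P.vertex j) with hI
  set u := P.cut I w with hu
  have hux : ∀ x, u.1.1 x = P.cutoffFun I x • w.1.1 x := fun x => rfl
  have hu0 : ∀ j ∈ J, u ∈ P.vanishing j := by
    intro j hj
    have h : ∀ᵐ x ∂volume.restrict (P.cell j), u.1.1 x = 0 := by
      filter_upwards [ae_restrict_mem (P.isOpen_cell j).measurableSet] with x hx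
      have : P.cutoffFun I x = 0 := Finset.sum_eq_zero fun n hn =>
        P.χ_support j n ((Finset.mem_filter.1 hn).2 j hj) x hx
      rw [hux, this, zero_smul]
    exact h
  have hu1 : ∀ j, (∀ k ∈ J, ¬ P.Touch j k) → u - w ∈ P.vanishing j := by
    intro j hj
    have h : ∀ᵐ x ∂volume.restrict (P.cell j), u.1.1 x - w.1.1 x = 0 := by
      filter_upwards [ae_restrict_mem (P.isOpen_cell j).measurableSet] with x hx
      have : P.cutoffFun I x = 1 := by
        rw [← P.χ_sum x (P.cell_subset_Ω j hx), Problem.cutoffFun]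
        refine Finset.sum_subset (Finset.subset_univ I) fun n _ hn => ?_
        refine P.χ_support j n ?_ x hx
        -- a common vertex would make the cell `j` touch a cell in `J`
        rintro ⟨c, rfl⟩
        refine hn (Finset.mem_filter.2 ⟨Finset.mem_univ _, fun k hk => ?_⟩)
        rintro ⟨c', hc'⟩
        refine hj k hk ⟨P.node (P.vertex j c), P.node_mem_closure j c, ?_⟩
        rw [← hc']
        exact P.node_mem_closure k c'
      rw [hux, this, one_smul, sub_self]
    exact h
  choose z hzv hzm hza hz0 using fun j => P.exists_lift hA hlift j (P.toL2 j u)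
  have hzsum : ∀ j, z j = 0 → ∑ k, z k ∈ P.vanishing j := fun j hj =>
    Submodule.sum_mem _ fun k _ => by
      by_cases hkj : j = k
      · rw [← hkj, hj]
        exact Submodule.zero_mem _
      · exact hzv k j hkj
  have hzdiff : ∀ j, ∑ k, z k - z j ∈ P.vanishing j := fun j => by
    rw [← Finset.sum_erase_eq_sub (Finset.mem_univ j)]
    exact Submodule.sum_mem _ fun k hk => hzv k j (Finset.ne_of_mem_erase hk).symm
  refine ⟨u - ∑ k, z k, fun j i => ?_, fun j hj => ?_, fun j hj => ?_, fun j => ?_⟩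
  · have h := P.sForm_eq_zero_of_vanishing (hzdiff j) (P.eig j i)
    simp only [map_sub, LinearMap.sub_apply] at h ⊢
    linarith [hzm j i]
  · exact Submodule.sub_mem _ (hu0 j hj) (hzsum j (hz0 j fun i =>
      P.sForm_eq_zero_of_vanishing (hu0 j hj) _))
  · have hz : z j = 0 := hz0 j fun i => by
      have h := P.sForm_eq_zero_of_vanishing (hu1 j hj) (P.eig j i)
      rw [map_sub, map_sub, LinearMap.sub_apply, hw j i, sub_zero] at h
      exact h
    rw [sub_right_comm]
    exact Submodule.sub_mem _ (hu1 j hj) (hzsum j hz)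
  · have e : P.aForm j (∑ k, z k) (∑ k, z k) = P.aForm j (z j) (z j) := by
      have h := fun v => P.aForm_eq_zero_of_vanishing (hzdiff j) v
      simp only [map_sub, LinearMap.sub_apply] at h
      rw [sub_eq_zero.1 (h _), P.aForm_comm, sub_eq_zero.1 (h _)]
    have h1 := form_sub_le (P.aForm_self_nonneg j) u (∑ k, z k)
    have h2 := P.aForm_cut_le I w j
    have h3 := (hza j).trans (mul_le_mul_of_nonneg_left (P.sForm_cut_le I w j) (sq_nonneg _))
    have h4 : P.sForm j (P.toL2 j w) (P.toL2 j w) ≤ Λ⁻¹ * P.aForm j w w := by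
      rw [inv_mul_eq_div, le_div_iff₀ hΛ, mul_comm]
      exact P.mul_sForm_le_aForm (hev j) hw
    rw [e] at h1
    have h5 := mul_le_mul_of_nonneg_left h4 (by positivity : (0 : ℝ) ≤ 2 * 2 ^ d)
    have h6 := mul_le_mul_of_nonneg_left h4 (sq_nonneg (A + 1))
    rw [cutConst]
    linarith

end AuxProblem

/-! ### Decay and localization for families of local forms -/

/-- What the localization argument needs: a positive semidefinite form for each cell, the relation
of touching between cells, a space `W` of constrained vectors, the spaces of vectors that vanish on
a cell, and a stable cutoff within `W`. -/
structure CutoffSystem (ι X : Type*) [AddCommGroup X] [Module ℝ X] (K : ℝ) where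
  form : ι → X →ₗ[ℝ] X →ₗ[ℝ] ℝ
  form_comm : ∀ j x y, form j x y = form j y x
  form_nonneg : ∀ j x, 0 ≤ form j x x
  touch : ι → ι → Prop
  touch_self : ∀ j, touch j j
  touch_symm : ∀ j k, touch j k → touch k j
  W : Submodule ℝ X
  vanishing : ι → Submodule ℝ X
  form_eq_zero : ∀ j, ∀ x ∈ vanishing j, ∀ y, form j x y = 0
  exists_cutoff : ∀ J : Finset ι, ∀ w ∈ W, ∃ v ∈ W, (∀ j ∈ J, v ∈ vanishing j) ∧
    (∀ j, (∀ k ∈ J, ¬ touch j k) → v - w ∈ vanishing j) ∧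
    ∀ j, form j v v ≤ K * form j w w

namespace CutoffSystem

variable {ι X : Type*} [AddCommGroup X] [Module ℝ X] {K : ℝ} (S : CutoffSystem ι X K)

theorem form_eq_zero_right {j : ι} {y : X} (hy : y ∈ S.vanishing j) (x : X) : S.form j x y = 0 := by
  rw [S.form_comm, S.form_eq_zero j y hy]

theorem form_sub_cutoff_le {j : ι} {v w : X} (h : S.form j v v ≤ K * S.form j w w) :
    S.form j (w - v) (w - v) ≤ 2 * (1 + K) * S.form j w w := by
  have := form_sub_le (S.form_nonneg j) w v
  linarith

theorem form_sub_eq_zero {j : ι} {v w : X} (h : v - w ∈ S.vanishing j) :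
    S.form j (w - v) (w - v) = 0 :=
  S.form_eq_zero j _ (by rw [← neg_sub]; exact Submodule.neg_mem _ h) _

variable [Fintype ι]

/-- The sum of the local forms. -/
def total : X →ₗ[ℝ] X →ₗ[ℝ] ℝ := ∑ j, S.form j

theorem total_apply (x y : X) : S.total x y = ∑ j, S.form j x y := by
  simp [total, LinearMap.sum_apply]

theorem total_comm (x y : X) : S.total x y = S.total y x := by
  simp only [total_apply, S.form_comm]

theorem total_nonneg (x : X) : 0 ≤ S.total x x := by
  rw [total_apply]
  exact Finset.sum_nonneg fun j _ => S.form_nonneg j x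

variable [DecidableEq ι]

/-- The energy of `w` outside `m` layers of cells around `i`. -/
def outer (i : ι) (m : ℕ) (w : X) : ℝ :=
  ∑ j, if j ∈ layer S.touch i m then 0 else S.form j w w

theorem outer_le_total (i : ι) (m : ℕ) (w : X) : S.outer i m w ≤ S.total w w := by
  rw [total_apply, outer]
  refine Finset.sum_le_sum fun j _ => ?_
  split_ifs
  · exact S.form_nonneg j w
  · exact le_rfl

/-- The decay over one layer: testing with the cutoff of `w` bounds the energy outside `m + 1`
layers by the energy in the layer `m + 1`. -/
theorem outer_succ_le (hK : 0 ≤ K) {i : ι} {w : X} (hw : w ∈ S.W)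
    (h : ∀ v ∈ S.W, v ∈ S.vanishing i → S.total w v = 0) (m : ℕ) :
    S.outer i (m + 1) w ≤ √K * (S.outer i m w - S.outer i (m + 1) w) := by
  obtain ⟨v, hvW, hv0, hv1, hvK⟩ := S.exists_cutoff (layer S.touch i m) w hw
  have hz := h v hvW (hv0 i (self_mem_layer S.touch_self i m))
  rw [total_apply] at hz
  have key : S.outer i (m + 1) w ≤
      ∑ j, S.form j w v + √K * (S.outer i m w - S.outer i (m + 1) w) := by
    simp only [outer]
    rw [← Finset.sum_sub_distrib, Finset.mul_sum, ← Finset.sum_add_distrib]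
    refine Finset.sum_le_sum fun j _ => ?_
    by_cases h1 : j ∈ layer S.touch i (m + 1)
    · by_cases h2 : j ∈ layer S.touch i m
      · simp [h1, h2, S.form_eq_zero_right (hv0 j h2)]
      · simp only [h1, h2, if_true, if_false, sub_zero]
        have b1 := form_abs_le (S.form_comm j) (S.form_nonneg j) w v
        have b2 : √(S.form j v v) ≤ √K * √(S.form j w w) := by
          rw [← Real.sqrt_mul hK]
          exact Real.sqrt_le_sqrt (hvK j)
        have b3 := mul_le_mul_of_nonneg_left b2 (Real.sqrt_nonneg (S.form j w w))
        have b4 := Real.mul_self_sqrt (S.form_nonneg j w)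
        have b5 := neg_abs_le (S.form j w v)
        have b6 : √(S.form j w w) * (√K * √(S.form j w w)) = √K * S.form j w w := by
          rw [← b4]
          simp only [Real.sqrt_mul_self (Real.sqrt_nonneg _)]
          ring
        linarith
    · have h2 : j ∉ layer S.touch i m := fun h => h1 (layer_subset_succ S.touch_self i m h)
      have h3 := S.form_eq_zero_right
        (hv1 j fun k hk hjk => h1 (mem_layer_succ.2 ⟨k, hk, hjk⟩)) w
      rw [map_sub] at h3
      simp only [h1, h2, if_false, sub_self, mul_zero, add_zero]
      linarith
  linarith

theorem outer_le (hK : 0 ≤ K) {i : ι} {w : X} (hw : w ∈ S.W)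
    (h : ∀ v ∈ S.W, v ∈ S.vanishing i → S.total w v = 0) (m : ℕ) :
    S.outer i m w ≤ (√K / (1 + √K)) ^ m * S.total w w := by
  have hs := Real.sqrt_nonneg K
  induction m with
  | zero => simpa using S.outer_le_total i 0 w
  | succ m ih =>
    have h1 := S.outer_succ_le hK hw h m
    have h2 : S.outer i (m + 1) w ≤ √K / (1 + √K) * S.outer i m w := by
      rw [div_mul_eq_mul_div, le_div_iff₀ (by positivity)]
      linarith
    rw [pow_succ', mul_assoc]
    exact h2.trans (mul_le_mul_of_nonneg_left ih (by positivity))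

/-- Quasi-optimality of the localized solution, compared with a cutoff of the global one. -/
theorem total_sub_le {i : ι} {m : ℕ} {w w' : X} (hw : w ∈ S.W) (hw' : w' ∈ S.W)
    (hv' : ∀ j ∉ layer S.touch i (m + 1), w' ∈ S.vanishing j)
    (h : ∀ v ∈ S.W, (∀ j ∉ layer S.touch i (m + 1), v ∈ S.vanishing j) →
      S.total (w - w') v = 0) :
    S.total (w - w') (w - w') ≤ 2 * (1 + K) * S.outer i m w := by
  obtain ⟨v, hvW, hv0, hv1, hvK⟩ := S.exists_cutoff (layer S.touch i (m + 1))ᶜ w hw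
  have hz := h (w' - v) (Submodule.sub_mem _ hw' hvW) fun j hj =>
    Submodule.sub_mem _ (hv' j hj) (hv0 j (Finset.mem_compl.2 hj))
  have h1 : S.total (w - w') (w - w') ≤ S.total (w - v) (w - v) := by
    have e : w - v = (w - w') + (w' - v) := by abel
    have h2 := S.total_nonneg (w' - v)
    have h3 := S.total_comm (w' - v) (w - w')
    rw [e]
    simp only [map_add, LinearMap.add_apply]
    linarith
  refine h1.trans ?_
  rw [total_apply, outer, Finset.mul_sum]
  refine Finset.sum_le_sum fun j _ => ?_
  split_ifs with hj
  · have hvan := hv1 j fun k hk hjk => (Finset.mem_compl.1 hk)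
      (mem_layer_succ.2 ⟨j, hj, S.touch_symm j k hjk⟩)
    rw [S.form_sub_eq_zero hvan, mul_zero]
  · exact S.form_sub_cutoff_le (hvK j)

/-- The energy of a sum of localization errors. Each error is orthogonal to the vectors of `W` that
vanish on its patch, so it only interacts with the sum on one more layer, and these patches overlap
at most `M` times. -/
theorem total_sum_le (hK : 0 ≤ K) {m : ℕ} {e : ι → X} (he : ∀ i, e i ∈ S.W)
    (h : ∀ i, ∀ v ∈ S.W, (∀ j ∈ layer S.touch i m, v ∈ S.vanishing j) → S.total (e i) v = 0)
    {M : ℝ} (hM : ∀ j, ((Finset.univ.filter fun i => j ∈ layer S.touch i (m + 1)).card : ℝ) ≤ M) :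
    S.total (∑ i, e i) (∑ i, e i) ≤ 2 * (1 + K) * M * ∑ i, S.total (e i) (e i) := by
  set f := ∑ i, e i with hf
  have hfW : f ∈ S.W := Submodule.sum_mem _ fun i _ => he i
  set F : ι → ℝ := fun i => ∑ j, if j ∈ layer S.touch i (m + 1) then S.form j f f else 0 with hF
  have hF0 : ∀ i, 0 ≤ F i := fun i => Finset.sum_nonneg fun j _ => by
    split_ifs
    · exact S.form_nonneg j f
    · exact le_rfl
  have h1 : ∀ i, S.total (e i) f ≤ √(S.total (e i) (e i)) * √(2 * (1 + K) * F i) := by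
    intro i
    obtain ⟨v, hvW, hv0, hv1, hvK⟩ := S.exists_cutoff (layer S.touch i m) f hfW
    have hz : S.total (e i) f = S.total (e i) (f - v) := by
      rw [map_sub, h i v hvW hv0, sub_zero]
    have hb : S.total (f - v) (f - v) ≤ 2 * (1 + K) * F i := by
      rw [total_apply, hF, Finset.mul_sum]
      refine Finset.sum_le_sum fun j _ => ?_
      split_ifs with hj
      · exact S.form_sub_cutoff_le (hvK j)
      · have hvan := hv1 j fun k hk hjk => hj (mem_layer_succ.2 ⟨k, hk, hjk⟩)
        rw [S.form_sub_eq_zero hvan, mul_zero]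
    rw [hz]
    refine (le_abs_self _).trans ((form_abs_le S.total_comm S.total_nonneg _ _).trans ?_)
    exact mul_le_mul_of_nonneg_left (Real.sqrt_le_sqrt hb) (Real.sqrt_nonneg _)
  have h2 : ∑ i, F i ≤ M * S.total f f := by
    rw [hF, Finset.sum_comm, total_apply, Finset.mul_sum]
    refine Finset.sum_le_sum fun j _ => ?_
    rw [← Finset.sum_filter, Finset.sum_const, nsmul_eq_mul]
    exact mul_le_mul_of_nonneg_right (hM j) (S.form_nonneg j f)
  set T := S.total f f with hT
  set Y := ∑ i, S.total (e i) (e i) with hY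
  have hT0 : 0 ≤ T := S.total_nonneg f
  have hY0 : 0 ≤ Y := Finset.sum_nonneg fun i _ => S.total_nonneg (e i)
  have h3 : T ≤ √Y * √(2 * (1 + K) * (M * T)) := by
    calc T = ∑ i, S.total (e i) f := by
          have e' : S.total f = ∑ i, S.total (e i) := by rw [hf, map_sum]
          rw [hT, e', LinearMap.sum_apply]
      _ ≤ ∑ i, √(S.total (e i) (e i)) * √(2 * (1 + K) * F i) := Finset.sum_le_sum fun i _ => h1 i
      _ ≤ √Y * √(∑ i, 2 * (1 + K) * F i) :=
          Real.sum_sqrt_mul_sqrt_le _ (fun i => S.total_nonneg (e i))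
            fun i => mul_nonneg (by positivity) (hF0 i)
      _ ≤ √Y * √(2 * (1 + K) * (M * T)) := by
          rw [← Finset.mul_sum]
          gcongr
  rcases hT0.eq_or_lt with h0 | h0
  · rw [← h0]
    rcases isEmpty_or_nonempty ι with hι | ⟨⟨j⟩⟩
    · simp [hY]
    · have : 0 ≤ M := (Nat.cast_nonneg _).trans (hM j)
      positivity
  · rw [← Real.sqrt_mul hY0, Real.le_sqrt' h0] at h3
    refine le_of_mul_le_mul_right ?_ h0
    linarith

end CutoffSystem

/-! ### Localization for the auxiliary problem -/

namespace AuxProblem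

variable (P : AuxProblem d)

/-- The local energies of an auxiliary problem, with the cutoff in the constrained space. -/
def cutoffSystem {Λ A : ℝ} (hΛ : 0 < Λ) (hA : 0 ≤ A) (hev : ∀ j, Λ ≤ P.nextEigenvalue j)
    (hlift : P.liftConst ≤ A) : CutoffSystem (Fin P.N) P.H1a (cutConst d Λ A) where
  form := P.aForm
  form_comm := P.aForm_comm
  form_nonneg := P.aForm_self_nonneg
  touch := P.Touch
  touch_self := P.touch_self
  touch_symm j k h := by rwa [CoarseMesh.Touch, inter_comm] at h
  W := P.constrained
  vanishing := P.vanishing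
  form_eq_zero _ _ h y := P.aForm_eq_zero_of_vanishing h y
  exists_cutoff J _ hw := P.exists_cutoff hΛ hA hev hlift J hw

theorem measurableSet_patch (i : Fin P.N) (m : ℕ) : MeasurableSet (P.patch i m) := by
  cases m with
  | zero => exact (P.isOpen_cell i).measurableSet
  | succ m =>
    exact (isOpen_biUnion fun j _ => P.isOpen_cell j).measurableSet.union
      isClosed_closure.measurableSet

theorem mem_WhOn_patch_iff {i : Fin P.N} {m : ℕ} {w : P.H1a} :
    w ∈ P.WhOn (P.patch i m) ↔
      w ∈ P.constrained ∧ ∀ j ∉ layer P.Touch i m, w ∈ P.vanishing j := by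
  rw [← P.mem_Wh_iff, ← P.ae_diff_iff (P.measurableSet_patch i m)
    (fun j hj => P.cell_subset_patch hj) fun j hj => P.disjoint_patch hj]
  rfl

theorem mem_WhOn_compl_cell {i : Fin P.N} {w : P.H1a} (hw : w ∈ P.constrained)
    (hv : w ∈ P.vanishing i) : w ∈ P.WhOn (P.Ω \ P.cell i) := by
  refine ⟨P.mem_Wh_iff.2 hw, ?_⟩
  rw [sdiff_sdiff_cancel_left (P.cell_subset_Ω i)]
  exact hv

end AuxProblem

end CEM

end

theorem lemma5 (d : ℕ) (hd : d = 2 ∨ d = 3) (ρ Λ A : ℝ) (hρ : 0 < ρ) (hΛ : 0 < Λ) (hA : 0 ≤ A) :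
    ∃ C δ : ℝ, 0 < C ∧ 0 < δ ∧ δ < 1 ∧
      ∀ P : CEM.AuxProblem d, P.IsRegular ρ → (∀ j, Λ ≤ P.nextEigenvalue j) → P.liftConst ≤ A →
      ∀ m : ℕ, 1 ≤ m →
      ∀ (B : Fin P.N → (P.H1a →ₗ[ℝ] ℝ)) (w wm : Fin P.N → P.H1a),
        (∀ i, ∀ v ∈ P.WhOn (P.Ω \ P.cell i), B i v = 0) →
        (∀ i, w i ∈ P.Wh) →
        (∀ i, ∀ v ∈ P.Wh, P.a P.Ω (w i) v = B i v) →
        (∀ i, wm i ∈ P.WhOn (P.patch i m)) →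
        (∀ i, ∀ v ∈ P.WhOn (P.patch i m), P.a (P.patch i m) (wm i) v = B i v) →
        P.aNorm ((∑ i, (w i - wm i) : P.H1a) : CEM.Displ d) ^ 2 +
            P.sNorm (∑ i, P.proj (w i - wm i : P.H1a).1.1) ^ 2 ≤
          C * (m : ℝ) ^ d * δ ^ m *
            (∑ i, P.aNorm (w i) ^ 2 + ∑ i, P.sNorm (P.proj (w i).1.1) ^ 2) := by
  set K := CEM.cutConst d Λ A with hKdef
  have hK : 0 < K := CEM.cutConst_pos d hΛ A
  have hsK : 0 < √K := Real.sqrt_pos.2 hK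
  set δ : ℝ := √K / (1 + √K) with hδ
  have hδ0 : 0 < δ := by positivity
  refine ⟨(2 * (1 + K)) ^ 2 * (3 / ρ) ^ d / δ, δ, by positivity, hδ0,
    (div_lt_one (by positivity)).2 (by linarith), ?_⟩
  intro P hreg hev hlift m hm B w wm hB hw hwB hwm hwmB
  obtain ⟨k, rfl⟩ : ∃ k, m = k + 1 := ⟨m - 1, by omega⟩
  have : Nonempty (Fin d) := ⟨⟨0, by omega⟩⟩
  let S := P.cutoffSystem hΛ hA hev hlift
  have hSt : ∀ u v : P.H1a, S.total u v = P.a P.Ω u v := fun u v => by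
    rw [S.total_apply, P.a_Ω_eq_sum]
    rfl
  have hwW : ∀ i, w i ∈ P.constrained := fun i => P.mem_Wh_iff.1 (hw i)
  have hwmW : ∀ i, wm i ∈ P.constrained := fun i => (P.mem_WhOn_patch_iff.1 (hwm i)).1
  have hwmv : ∀ i, ∀ j ∉ CEM.layer P.Touch i (k + 1), wm i ∈ P.vanishing j := fun i =>
    (P.mem_WhOn_patch_iff.1 (hwm i)).2
  have heW : ∀ i, w i - wm i ∈ P.constrained := fun i => Submodule.sub_mem _ (hwW i) (hwmW i)
  have hw0 : ∀ i, ∀ v ∈ S.W, v ∈ S.vanishing i → S.total (w i) v = 0 := fun i v hv hvi => by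
    rw [hSt, hwB i v (P.mem_Wh_iff.2 hv), hB i v (P.mem_WhOn_compl_cell hv hvi)]
  have hortho : ∀ i, ∀ v ∈ S.W, (∀ j ∉ CEM.layer S.touch i (k + 1), v ∈ S.vanishing j) →
      S.total (w i - wm i) v = 0 := by
    intro i v hv hvj
    have h1 : S.total (wm i) v = B i v := by
      rw [← hwmB i v (P.mem_WhOn_patch_iff.2 ⟨hv, hvj⟩), P.a_patch_eq_sum, S.total_apply]
      refine (Finset.sum_subset (Finset.subset_univ _) fun j _ hj => ?_).symm
      exact P.aForm_eq_zero_of_vanishing (hwmv i j hj) v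
    rw [map_sub, LinearMap.sub_apply, h1, hSt, hwB i v (P.mem_Wh_iff.2 hv), sub_self]
  have hortho' : ∀ i, ∀ v ∈ S.W, (∀ j ∈ CEM.layer S.touch i (k + 1), v ∈ S.vanishing j) →
      S.total (w i - wm i) v = 0 := by
    intro i v hv hvj
    have h1 : S.total (wm i) v = 0 := by
      rw [S.total_apply]
      refine Finset.sum_eq_zero fun j _ => ?_
      by_cases hj : j ∈ CEM.layer S.touch i (k + 1)
      · exact S.form_eq_zero_right (hvj j hj) _
      · exact P.aForm_eq_zero_of_vanishing (hwmv i j hj) v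
    rw [map_sub, LinearMap.sub_apply, h1, sub_zero]
    exact hw0 i v hv (hvj i (CEM.self_mem_layer S.touch_self i _))
  have herr : ∀ i, S.total (w i - wm i) (w i - wm i) ≤
      2 * (1 + K) * (δ ^ k * S.total (w i) (w i)) := fun i =>
    (S.total_sub_le (hwW i) (hwmW i) (hwmv i) (hortho i)).trans
      (mul_le_mul_of_nonneg_left (S.outer_le hK.le (hwW i) (hw0 i) k) (by positivity))
  have hsum := S.total_sum_le hK.le (m := k + 1) (e := fun i => w i - wm i) heW hortho'
    (M := (3 / ρ) ^ d * ((k + 1 : ℕ) : ℝ) ^ d) fun j => by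
      refine (P.card_layer_le hρ hreg (k + 1 + 1) j _
        fun i hi => (Finset.mem_filter.1 hi).2).trans ?_
      rw [← mul_pow]
      refine pow_le_pow_left₀ (by positivity) ?_ d
      rw [div_mul_eq_mul_div]
      gcongr
      push_cast
      linarith
  have ha : ∀ u : P.H1a, P.aNorm u ^ 2 = S.total u u := fun u => by
    rw [S.total_apply]
    exact P.aNorm_sq u
  have hs : P.sNorm (∑ i, P.proj (w i - wm i : P.H1a).1.1) = 0 := by
    rw [Finset.sum_eq_zero fun i _ => P.proj_eq_zero (heW i)]
    simp [CEM.Problem.sNorm, CEM.Problem.s]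
  have hY : 0 ≤ ∑ i, P.sNorm (P.proj (w i).1.1) ^ 2 := Finset.sum_nonneg fun i _ => sq_nonneg _
  have hδk : δ ^ k = δ ^ (k + 1) / δ := by
    rw [pow_succ, mul_div_assoc, div_self hδ0.ne', mul_one]
  rw [hs, ha]
  calc _ ≤ 2 * (1 + K) * ((3 / ρ) ^ d * ((k + 1 : ℕ) : ℝ) ^ d) *
        ∑ i, S.total (w i - wm i) (w i - wm i) + 0 ^ 2 := by gcongr
    _ ≤ 2 * (1 + K) * ((3 / ρ) ^ d * ((k + 1 : ℕ) : ℝ) ^ d) *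
        ∑ i, 2 * (1 + K) * (δ ^ k * S.total (w i) (w i)) := by
      rw [zero_pow two_ne_zero, add_zero]
      gcongr with i _
      exact herr i
    _ = (2 * (1 + K)) ^ 2 * (3 / ρ) ^ d / δ * ((k + 1 : ℕ) : ℝ) ^ d * δ ^ (k + 1) *
        ∑ i, P.aNorm (w i) ^ 2 := by
      simp only [ha, ← Finset.mul_sum]
      rw [hδk]
      ring
    _ ≤ _ := by
      gcongr
      linarith
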